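/- **Setting.** Two-sorted functions take as arguments numbers $\vec x$ from $\mathbb N$ and strings $\vec X$, a string being a finite subset of $\mathbb N$ (bit $i$ of $X$ is $1$ iff $i\in X$, written $X(i)$). Their value is a number (number functions) or a string (string functions). The length $|X|$ is $1+\max X$, with $|\emptyset|=0$, and $\mathrm{bin}(X)=\sum_{i\in X}2^i$. *$AC^0$-reducibility.* For a collection $\mathcal L$ of two-sorted functions and relations, a $\Sigma_0^B(\mathcal L)$-formula is a formula over the symbols $0,1,+,\cdot,|\ |,=,\le,\in$ and the symbols of $\mathcal L$, interpreted in the standard model, whose only quantifiers are bounded number quantifiers $\exists x\le t$, $\forall x\le t$. A number function $f$ (string function $F$) is $\Sigma_0^B$-definable from $\mathcal L$ if its value (the length of its value) is bounded by a polynomial in the number arguments and the lengths of the string arguments, and its graph $y=f(\vec x,\vec X)$ (its bit graph $i\in F(\vec x,\vec X)$) is represented by a $\Sigma_0^B(\mathcal L)$-formula. A function is $AC^0$-reducible to $\mathcal L$ if there are string functions $F_1,\dots,F_r$ ($r\ge 0$) such that each $F_i$ is $\Sigma_0^B$-definable from $\mathcal L\cup\{F_1,\dots,F_{i-1}\}$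 and the function is $\Sigma_0^B$-definable from $\mathcal L\cup\{F_1,\dots,F_r\}$. *The classes.* $\#L$ is the class of string functions $F(\vec x,\vec X)$ for which there is a nondeterministic Turing machine, with a read-only input tape and a read-write work tape, working in logarithmic space and halting in polynomial time on all inputs, that has exactly $\mathrm{bin}(F(\vec x,\vec X))$ accepting computation paths on input $(\vec x,\vec X)$; here numbers are presented in unary, strings as bit strings, and each argument is followed by a separator. $DET$ is the class of all number functions and string functions that are $AC^0$-reducible to $\#L$. *Unary matrix powering over $\mathbb N$.* Let $\langle x,y\rangle=(x+y)(x+y+1)+2y$, let $Z^{[x]}$ be the string with $Z^{[x]}(i)\leftrightarrow i<|Z|\wedge Z(\langle x,i\rangle)$, and let $(Z)^{x}$ be the least $y<|Z|$ with $Z(\langle x,y\rangle)$, or $|Z|$ if there is none. A string $X$ encodes in unary the $n\times n$ matrix $A$ over $\mathbb N$ with entries $A[i,j]=(X^{[i]})^{j}$ for $0\le i,j<n$. Unary matrix powering over $\mathbb N$ is the string function $(n,k,X)\mapsto Z$, where for all $i,j<n$ the string $Z^{[i][j]}=(Z^{[i]})^{[j]}$ is the binary notation (least significant bit first) of the entry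 $A^k[i,j]$, and all other bits of $Z$ are $0$. **Claim.** Unary matrix powering over $\mathbb N$ is $AC^0$-complete for $DET$: it belongs to $DET$, and every function in $DET$ is $AC^0$-reducible to it. -/

import Mathlib

namespace TwoSorted

/-! ## Numbers and strings -/

/-- A string is a finite set of natural numbers; `i ∈ X` means that bit `i` of `X` is `1`. -/
abbrev Str : Type := Finset ℕ

/-- The length `|X|`: one more than the largest element of `X`, and `0` for the empty string. -/
def len (X : Str) : ℕ := X.sup (fun i => i + 1)

/-- Two-sorted number functions with `a` number arguments and `b` string arguments. -/
abbrev NumFun (a b : ℕ) : Type := (Fin a → ℕ) → (Fin b → Str) → ℕ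

/-- Two-sorted string functions with `a` number arguments and `b` string arguments. -/
abbrev StrFun (a b : ℕ) : Type := (Fin a → ℕ) → (Fin b → Str) → Str

/-- Two-sorted relations with `a` number arguments and `b` string arguments. -/
abbrev Rel (a b : ℕ) : Type := (Fin a → ℕ) → (Fin b → Str) → Prop

/-- A collection of two-sorted functions and relations. -/
structure Collection where
  num : ∀ a b : ℕ, Set (NumFun a b)
  str : ∀ a b : ℕ, Set (StrFun a b)
  rel : ∀ a b : ℕ, Set (Rel a b)

/-! ## Bounded formulas -/

mutual
/-- Number terms over the basic vocabulary of two-sorted arithmetic together with the functions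
of `L`, with free number variables `0, …, n - 1` and free string variables `0, …, m - 1`. -/
inductive NumTerm (L : Collection) (n m : ℕ) : Type
  | var (i : Fin n) : NumTerm L n m
  | zero : NumTerm L n m
  | one : NumTerm L n m
  | add (s t : NumTerm L n m) : NumTerm L n m
  | mul (s t : NumTerm L n m) : NumTerm L n m
  | len (T : StrTerm L n m) : NumTerm L n m
  | app {a b : ℕ} (f : NumFun a b) (hf : f ∈ L.num a b)
      (ts : Fin a → NumTerm L n m) (Ts : Fin b → StrTerm L n m) : NumTerm L n m

/-- String terms over `L`. -/
inductive StrTerm (L : Collection) (n m : ℕ) : Type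
  | var (i : Fin m) : StrTerm L n m
  | app {a b : ℕ} (F : StrFun a b) (hF : F ∈ L.str a b)
      (ts : Fin a → NumTerm L n m) (Ts : Fin b → StrTerm L n m) : StrTerm L n m
end

mutual
/-- Value of a number term in the standard model. -/
def NumTerm.eval {L : Collection} {n m : ℕ} (x : Fin n → ℕ) (X : Fin m → Str) :
    NumTerm L n m → ℕ
  | .var i => x i
  | .zero => 0
  | .one => 1
  | .add s t => s.eval x X + t.eval x X
  | .mul s t => s.eval x X * t.eval x X
  | .len T => TwoSorted.len (T.eval x X)
  | .app f _ ts Ts => f (fun i => (ts i).eval x X) (fun i => (Ts i).eval x X)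

/-- Value of a string term in the standard model. -/
def StrTerm.eval {L : Collection} {n m : ℕ} (x : Fin n → ℕ) (X : Fin m → Str) :
    StrTerm L n m → Str
  | .var i => X i
  | .app F _ ts Ts => F (fun i => (ts i).eval x X) (fun i => (Ts i).eval x X)
end

/-- `Σ₀ᴮ(L)`-formulas: the only quantifiers are bounded number quantifiers. In
`existsLE t φ` and `forallLE t φ` the quantified variable is number variable `0` of `φ`, and the
number variables of the bound `t` are the remaining ones. -/
inductive Formula (L : Collection) (m : ℕ) : ℕ → Type
  | eqNum {n : ℕ} (s t : NumTerm L n m) : Formula L m n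
  | leNum {n : ℕ} (s t : NumTerm L n m) : Formula L m n
  | eqStr {n : ℕ} (S T : StrTerm L n m) : Formula L m n
  | mem {n : ℕ} (t : NumTerm L n m) (T : StrTerm L n m) : Formula L m n
  | rel {n a b : ℕ} (R : Rel a b) (hR : R ∈ L.rel a b)
      (ts : Fin a → NumTerm L n m) (Ts : Fin b → StrTerm L n m) : Formula L m n
  | not {n : ℕ} (φ : Formula L m n) : Formula L m n
  | and {n : ℕ} (φ ψ : Formula L m n) : Formula L m n
  | or {n : ℕ} (φ ψ : Formula L m n) : Formula L m n
  | existsLE {n : ℕ} (t : NumTerm L n m) (φ : Formula L m (n + 1)) : Formula L m n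
  | forallLE {n : ℕ} (t : NumTerm L n m) (φ : Formula L m (n + 1)) : Formula L m n

/-- Truth of a formula in the standard model. -/
def Formula.Holds {L : Collection} {m : ℕ} (X : Fin m → Str) :
    {n : ℕ} → Formula L m n → (Fin n → ℕ) → Prop
  | _, .eqNum s t, x => s.eval x X = t.eval x X
  | _, .leNum s t, x => s.eval x X ≤ t.eval x X
  | _, .eqStr S T, x => S.eval x X = T.eval x X
  | _, .mem t T, x => t.eval x X ∈ T.eval x X
  | _, .rel R _ ts Ts, x => R (fun i => (ts i).eval x X) (fun i => (Ts i).eval x X)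
  | _, .not φ, x => ¬ φ.Holds X x
  | _, .and φ ψ, x => φ.Holds X x ∧ ψ.Holds X x
  | _, .or φ ψ, x => φ.Holds X x ∨ ψ.Holds X x
  | _, .existsLE t φ, x => ∃ y ≤ t.eval x X, φ.Holds X (Fin.cons y x : Fin _ → ℕ)
  | _, .forallLE t φ, x => ∀ y ≤ t.eval x X, φ.Holds X (Fin.cons y x : Fin _ → ℕ)

/-! ## `Σ₀ᴮ`-definability and `AC⁰`-reducibility -/

/-- A number function is p-bounded if its value is at most a polynomial in its number arguments
and the lengths of its string arguments. -/
def NumPBounded {a b : ℕ} (f : NumFun a b) : Prop :=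
  ∃ p : MvPolynomial (Fin a ⊕ Fin b) ℕ, ∀ x X,
    f x X ≤ MvPolynomial.eval (Sum.elim x (fun i => len (X i))) p

/-- A string function is p-bounded if the length of its value is at most a polynomial in its
number arguments and the lengths of its string arguments. -/
def StrPBounded {a b : ℕ} (F : StrFun a b) : Prop :=
  ∃ p : MvPolynomial (Fin a ⊕ Fin b) ℕ, ∀ x X,
    len (F x X) ≤ MvPolynomial.eval (Sum.elim x (fun i => len (X i))) p

/-- `f` is `Σ₀ᴮ`-definable from `L`: it is p-bounded and its graph is represented by a
`Σ₀ᴮ(L)`-formula. -/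
def NumDefinable (L : Collection) {a b : ℕ} (f : NumFun a b) : Prop :=
  NumPBounded f ∧ ∃ φ : Formula L b (a + 1), ∀ (y : ℕ) (x : Fin a → ℕ) (X : Fin b → Str),
    φ.Holds X (Fin.cons y x : Fin (a + 1) → ℕ) ↔ y = f x X

/-- `F` is `Σ₀ᴮ`-definable from `L`: it is p-bounded and its bit graph is represented by a
`Σ₀ᴮ(L)`-formula. -/
def StrDefinable (L : Collection) {a b : ℕ} (F : StrFun a b) : Prop :=
  StrPBounded F ∧ ∃ φ : Formula L b (a + 1), ∀ (i : ℕ) (x : Fin a → ℕ) (X : Fin b → Str),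
    φ.Holds X (Fin.cons i x : Fin (a + 1) → ℕ) ↔ i ∈ F x X

/-- `L ∪ {F}` for the string functions `F` in a list. -/
def Collection.adjoin (L : Collection) (Fs : List (Σ a b : ℕ, StrFun a b)) : Collection where
  num := L.num
  str := fun a b => L.str a b ∪ {F | (⟨a, b, F⟩ : Σ a b : ℕ, StrFun a b) ∈ Fs}
  rel := L.rel

/-- The list (latest function first) is a sequence of string functions each of which is
`Σ₀ᴮ`-definable from `L` and the earlier ones. -/
def DefinableSeq (L : Collection) : List (Σ a b : ℕ, StrFun a b) → Prop
  | [] => True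
  | F :: Fs => StrDefinable (L.adjoin Fs) F.2.2 ∧ DefinableSeq L Fs

/-- `AC⁰`-reducibility of a number function to a collection. -/
def NumReducible {a b : ℕ} (f : NumFun a b) (L : Collection) : Prop :=
  ∃ Fs, DefinableSeq L Fs ∧ NumDefinable (L.adjoin Fs) f

/-- `AC⁰`-reducibility of a string function to a collection. -/
def StrReducible {a b : ℕ} (F : StrFun a b) (L : Collection) : Prop :=
  ∃ Fs, DefinableSeq L Fs ∧ StrDefinable (L.adjoin Fs) F

/-! ## Nondeterministic logspace machines and `#L` -/

/-- Symbols that can be read on the input tape. -/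
inductive InputSymbol : Type
  | bit (b : Bool)
  | sep
  | leftEnd
  | rightEnd

/-- Head movements. -/
inductive Move : Type
  | left
  | stay
  | right

/-- The displacement of a head movement. -/
def Move.toInt : Move → ℤ
  | .left => -1
  | .stay => 0
  | .right => 1

/-- A nondeterministic Turing machine with a two-way read-only input tape and a two-way infinite
read-write work tape. `trans q i g q' g' d d'` says that in state `q`, reading `i` on the input
tape and `g` on the work tape, the machine may enter state `q'`, write `g'` on the work tape, move
the input head by `d` and the work head by `d'`. -/
structure Machine where
  State : Type
  finState : Finite State
  Symbol : Type
  finSymbol : Finite Symbol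
  start : State
  accept : Set State
  blank : Symbol
  trans : State → InputSymbol → Symbol → State → Symbol → Move → Move → Prop

namespace Machine

/-- Configurations of a machine. -/
structure Config (M : Machine) where
  state : M.State
  inputPos : ℕ
  work : ℤ → M.Symbol
  workPos : ℤ

/-- The symbol at an input position: the word `w` occupies positions `1, …, |w|` and is enclosed
between end markers. -/
def readInput (w : List InputSymbol) : ℕ → InputSymbol
  | 0 => .leftEnd
  | i + 1 => w.getD i .rightEnd

/-- The initial configuration: empty work tape, input head on the left end marker. -/
def init (M : Machine) : M.Config where
  state := M.start
  inputPos := 0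
  work := fun _ => M.blank
  workPos := 0

/-- One step on input `w`. A transition that would move the input head beyond an end marker is not
applicable. Distinct applicable transitions lead to distinct configurations, so a computation path
is determined by its sequence of configurations. -/
def Step (M : Machine) (w : List InputSymbol) (c c' : M.Config) : Prop :=
  ∃ (g : M.Symbol) (d d' : Move),
    M.trans c.state (readInput w c.inputPos) (c.work c.workPos) c'.state g d d' ∧
    (c'.inputPos : ℤ) = c.inputPos + d.toInt ∧
    c'.inputPos ≤ w.length + 1 ∧
    c'.work = Function.update c.work c.workPos g ∧
    c'.workPos = c.workPos + d'.toInt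

/-- The (partial) computation paths on input `w`. -/
def IsPath (M : Machine) (w : List InputSymbol) (p : List M.Config) : Prop :=
  p.head? = some M.init ∧ p.IsChain (M.Step w)

/-- The accepting computation paths on input `w`: those that end in a halting configuration whose
state is accepting. -/
def acceptingPaths (M : Machine) (w : List InputSymbol) : Set (List M.Config) :=
  {p | M.IsPath w p ∧
    ∃ c, p.getLast? = some c ∧ c.state ∈ M.accept ∧ ∀ c', ¬ M.Step w c c'}

end Machine

/-- A number `x` on the input tape: in unary, followed by a separator. -/
def encodeNum (x : ℕ) : List InputSymbol := List.replicate x (.bit true) ++ [.sep]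

/-- A string `X` on the input tape: its bits `X(0), …, X(|X| - 1)`, followed by a separator. -/
def encodeStr (X : Str) : List InputSymbol :=
  (List.range (len X)).map (fun i => .bit (decide (i ∈ X))) ++ [.sep]

/-- The input word for a tuple of arguments. -/
def encodeInput {a b : ℕ} (x : Fin a → ℕ) (X : Fin b → Str) : List InputSymbol :=
  (List.ofFn (fun i => encodeNum (x i))).flatten ++ (List.ofFn (fun i => encodeStr (X i))).flatten

/-- The number with binary notation `X`, least significant bit first. -/
def bin (X : Str) : ℕ := ∑ i ∈ X, 2 ^ i

/-- `F` is in `#L`: there is a nondeterministic machine that on every input works in logarithmic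
space, halts in polynomial time on every path, and has exactly `F` (written in binary) accepting
computation paths. -/
def IsSharpL {a b : ℕ} (F : StrFun a b) : Prop :=
  ∃ (M : Machine) (c : ℕ) (T : Polynomial ℕ), ∀ (x : Fin a → ℕ) (X : Fin b → Str),
    (∀ p, M.IsPath (encodeInput x X) p →
      p.length ≤ T.eval (encodeInput x X).length ∧
      ∀ k ∈ p, k.workPos.natAbs ≤ c * (Nat.log 2 (encodeInput x X).length + 1)) ∧
    (M.acceptingPaths (encodeInput x X)).encard = (bin (F x X) : ℕ∞)

/-- The class `#L`. -/
def sharpL : Collection where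
  num := fun _ _ => ∅
  str := fun _ _ => {F | IsSharpL F}
  rel := fun _ _ => ∅

/-- The class `DET` of the number and string functions that are `AC⁰`-reducible to `#L`. -/
def DET : Collection where
  num := fun _ _ => {f | NumReducible f sharpL}
  str := fun _ _ => {F | StrReducible F sharpL}
  rel := fun _ _ => ∅

/-- The collection whose only member is the string function `F`. -/
def Collection.single {a b : ℕ} (F : StrFun a b) : Collection where
  num := fun _ _ => ∅
  str := fun a' b' => {G | (⟨a', b', G⟩ : Σ a b : ℕ, StrFun a b) = ⟨a, b, F⟩}
  rel := fun _ _ => ∅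

/-- `F` is `AC⁰`-complete for the class `C`: it belongs to `C` and every number or string function
of `C` is `AC⁰`-reducible to `F`. -/
def IsACZeroComplete {a b : ℕ} (F : StrFun a b) (C : Collection) : Prop :=
  F ∈ C.str a b ∧
  (∀ (a' b' : ℕ), ∀ G ∈ C.str a' b', StrReducible G (Collection.single F)) ∧
  (∀ (a' b' : ℕ), ∀ g ∈ C.num a' b', NumReducible g (Collection.single F))

/-! ## Unary matrix powering -/

/-- The pairing function `⟨x, y⟩`. -/
def pair (x y : ℕ) : ℕ := (x + y) * (x + y + 1) + 2 * y

/-- `Row(x, Z) = Z^[x]`, the string whose bit `i` is bit `⟨x, i⟩` of `Z`. -/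
def row (x : ℕ) (Z : Str) : Str := (Finset.range (len Z)).filter (fun i => pair x i ∈ Z)

/-- `seq(x, Z) = (Z)^x`: the least `y < |Z|` with `Z(x, y)`, and `|Z|` if there is none. -/
def seq (x : ℕ) (Z : Str) : ℕ :=
  if h : ∃ y, y < len Z ∧ pair x y ∈ Z then Nat.find h else len Z

/-- `entry(i, j, Z) = (Z^[i])^j`. -/
def entry (i j : ℕ) (Z : Str) : ℕ := seq j (row i Z)

/-- The `n × n` matrix over `ℕ` encoded in unary by `X`. -/
def unaryMatrix (n : ℕ) (X : Str) : Matrix (Fin n) (Fin n) ℕ :=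
  Matrix.of fun i j => entry i j X

/-- The binary notation of a number, least significant bit first. -/
def binStr (m : ℕ) : Str := (Finset.range m.size).filter (fun i => m.testBit i = true)

/-- The string `Z` that encodes a matrix over `ℕ` in binary: `Z^[i][j]` is the binary notation of
the `(i, j)` entry, and all bits of `Z` that this does not mention are `0`. -/
def encodeBinaryMatrix {n : ℕ} (A : Matrix (Fin n) (Fin n) ℕ) : Str :=
  Finset.univ.biUnion fun i : Fin n => Finset.univ.biUnion fun j : Fin n =>
    (binStr (A i j)).image fun l => pair i (pair j l)

/-- Unary matrix powering over `ℕ`: `(n, k, X) ↦ Aᵏ`, where `A` is the `n × n` matrix that `X`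
encodes in unary and the entries of `Aᵏ` are written in binary. -/
def unaryMatrixPowering : StrFun 2 1 := fun x X =>
  encodeBinaryMatrix (unaryMatrix (x 0) (X 0) ^ x 1)

end TwoSorted

/-!
Matrix powering counts walks in a graph, and so does a nondeterministic logspace machine; both
halves of the completeness result turn one kind of counting into the other.

*Hardness.* A configuration of a machine in `#L` is coded by a number: the two halves of the work
tape, seen from the work head, are two stacks of base-`B` digits. They have logarithmic height, so
the codes are polynomially bounded (`Machine.Config.Tidy.code_lt`), and a step pushes a digit on one
stack and pops one from the other, which is expressed by linear equations between the codes
(`Machine.tapeRel_iff`). Hence the configuration graph is given by a `Σ₀ᴮ`-formula without any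
coding of sequences. Edges from the accepting halting configurations to a sink with a loop are
added; since all paths have length at most `t`, the number of accepting paths is the number of
walks with `t` edges to the sink (`encard_accPaths_eq_walkCount`), which is an entry of the `t`-th
power of the adjacency matrix. So every function of `#L` occurs in a sequence of functions definable
from matrix powering (`IsSharpL.exists_definableSeq`). Replacing the `#L` functions in formulas in
this way extends this to all of `DET` (`StrReducible.trans`, `NumReducible.trans`).

*Membership.* The entry `(i, j)` of the `k`-th power of a matrix of unary numbers is the number of
walks from node `i` of layer `0` to node `j` of layer `k` in a layered multigraph. This graph is
written, by a `Σ₀ᴮ`-formula (`SlotBit`), as a string with one block of equally wide slots for each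
node; a slot holds a run of ones that tells how many blocks an edge jumps over. A one-way machine
with a binary counter (`Walker.machine`) walks through this string: it guesses one edge of the
present block, reads the length of its run into the counter and counts it down while passing the
ends of blocks. As all edges lead to later blocks, one pass suffices, and the machine has as many
accepting paths as the graph has walks from the initial node to the exit
(`Walker.scanCount_blocksFrom`, `scanCount_layer`). Thus the bits of a matrix power are bits of
values of one function of `#L`, at arguments definable in `AC⁰` (`walks_slotStr`).

Definability of terms, string terms and formulas is expressed by the classes `TermDef`,
`StrTermDef` and `RelDef`, so that instance search constructs the required formulas from the shape
of a relation.
-/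

namespace TwoSorted

/-! ### Definable terms and relations -/

/-- `f` is the value of a number term over `L`. -/
class TermDef (L : Collection) {n m : ℕ} (f : NumFun n m) : Prop where
  out : ∃ t : NumTerm L n m, ∀ x X, t.eval x X = f x X

/-- `F` is the value of a string term over `L`. -/
class StrTermDef (L : Collection) {n m : ℕ} (F : StrFun n m) : Prop where
  out : ∃ t : StrTerm L n m, ∀ x X, t.eval x X = F x X

/-- `R` is represented by a `Σ₀ᴮ(L)`-formula. -/
class RelDef (L : Collection) {n m : ℕ} (R : Rel n m) : Prop where
  out : ∃ φ : Formula L m n, ∀ x X, φ.Holds X x ↔ R x X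

section
variable {L : Collection} {n m : ℕ}

mutual
/-- Renaming of the number variables of a number term. -/
def NumTerm.rename {n' : ℕ} (ρ : Fin n → Fin n') : NumTerm L n m → NumTerm L n' m
  | .var i => .var (ρ i)
  | .zero => .zero
  | .one => .one
  | .add s t => .add (s.rename ρ) (t.rename ρ)
  | .mul s t => .mul (s.rename ρ) (t.rename ρ)
  | .len T => .len (T.rename ρ)
  | .app f hf ts Ts => .app f hf (fun i => (ts i).rename ρ) (fun i => (Ts i).rename ρ)

/-- Renaming of the number variables of a string term. -/
def StrTerm.rename {n' : ℕ} (ρ : Fin n → Fin n') : StrTerm L n m → StrTerm L n' m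
  | .var i => .var i
  | .app F hF ts Ts => .app F hF (fun i => (ts i).rename ρ) (fun i => (Ts i).rename ρ)
end

mutual
theorem NumTerm.eval_rename {n' : ℕ} (ρ : Fin n → Fin n') (x : Fin n' → ℕ) (X : Fin m → Str) :
    ∀ t : NumTerm L n m, (t.rename ρ).eval x X = t.eval (fun i => x (ρ i)) X
  | .var i => rfl
  | .zero => rfl
  | .one => rfl
  | .add s t => by
    simp only [NumTerm.rename, NumTerm.eval, NumTerm.eval_rename ρ x X s,
      NumTerm.eval_rename ρ x X t]
  | .mul s t => by
    simp only [NumTerm.rename, NumTerm.eval, NumTerm.eval_rename ρ x X s,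
      NumTerm.eval_rename ρ x X t]
  | .len T => by
    simp only [NumTerm.rename, NumTerm.eval, StrTerm.eval_rename ρ x X T]
  | .app f hf ts Ts => by
    simp only [NumTerm.rename, NumTerm.eval, fun i => NumTerm.eval_rename ρ x X (ts i),
      fun i => StrTerm.eval_rename ρ x X (Ts i)]

theorem StrTerm.eval_rename {n' : ℕ} (ρ : Fin n → Fin n') (x : Fin n' → ℕ) (X : Fin m → Str) :
    ∀ T : StrTerm L n m, (T.rename ρ).eval x X = T.eval (fun i => x (ρ i)) X
  | .var i => rfl
  | .app F hF ts Ts => by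
    simp only [StrTerm.rename, StrTerm.eval, fun i => NumTerm.eval_rename ρ x X (ts i),
      fun i => StrTerm.eval_rename ρ x X (Ts i)]
end

instance TermDef.var (i : Fin n) : TermDef L (fun x (_ : Fin m → Str) => x i) :=
  ⟨.var i, fun _ _ => rfl⟩

instance StrTermDef.var (i : Fin m) : StrTermDef L (fun (_ : Fin n → ℕ) X => X i) :=
  ⟨.var i, fun _ _ => rfl⟩

instance TermDef.add {f g : NumFun n m} [hf : TermDef L f] [hg : TermDef L g] :
    TermDef L (fun x X => f x X + g x X) := by
  obtain ⟨s, hs⟩ := hf; obtain ⟨t, ht⟩ := hg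
  exact ⟨.add s t, fun x X => by simp only [NumTerm.eval, hs, ht]⟩

instance TermDef.mul {f g : NumFun n m} [hf : TermDef L f] [hg : TermDef L g] :
    TermDef L (fun x X => f x X * g x X) := by
  obtain ⟨s, hs⟩ := hf; obtain ⟨t, ht⟩ := hg
  exact ⟨.mul s t, fun x X => by simp only [NumTerm.eval, hs, ht]⟩

instance TermDef.len {F : StrFun n m} [hF : StrTermDef L F] :
    TermDef L (fun x X => len (F x X)) := by
  obtain ⟨s, hs⟩ := hF
  exact ⟨.len s, fun x X => by simp only [NumTerm.eval, hs]⟩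

instance (priority := low) TermDef.const (c : ℕ) :
    TermDef L (fun (_ : Fin n → ℕ) (_ : Fin m → Str) => c) := by
  induction c with
  | zero => exact ⟨.zero, fun _ _ => rfl⟩
  | succ c ih =>
    obtain ⟨t, ht⟩ := ih
    exact ⟨.add t .one, fun x X => by simp only [NumTerm.eval, ht]⟩

/-- A term may be used below quantifiers, where its variables have other numbers. -/
instance (priority := low) TermDef.rename {n' : ℕ} (ρ : Fin n → Fin n') {f : NumFun n m}
    [hf : TermDef L f] : TermDef L (fun x X => f (fun i => x (ρ i)) X) := by
  obtain ⟨t, ht⟩ := hf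
  exact ⟨t.rename ρ, fun x X => by rw [NumTerm.eval_rename, ht]⟩

instance (priority := low) StrTermDef.rename {n' : ℕ} (ρ : Fin n → Fin n') {F : StrFun n m}
    [hF : StrTermDef L F] : StrTermDef L (fun x X => F (fun i => x (ρ i)) X) := by
  obtain ⟨t, ht⟩ := hF
  exact ⟨t.rename ρ, fun x X => by rw [StrTerm.eval_rename, ht]⟩

instance RelDef.le {f g : NumFun n m} [hf : TermDef L f] [hg : TermDef L g] :
    RelDef L (fun x X => f x X ≤ g x X) := by
  obtain ⟨s, hs⟩ := hf; obtain ⟨t, ht⟩ := hg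
  exact ⟨.leNum s t, fun x X => by simp only [Formula.Holds, hs, ht]⟩

instance RelDef.lt {f g : NumFun n m} [hf : TermDef L f] [hg : TermDef L g] :
    RelDef L (fun x X => f x X < g x X) :=
  inferInstanceAs (RelDef L (fun x X => f x X + 1 ≤ g x X))

instance RelDef.eq {f g : NumFun n m} [hf : TermDef L f] [hg : TermDef L g] :
    RelDef L (fun x X => f x X = g x X) := by
  obtain ⟨s, hs⟩ := hf; obtain ⟨t, ht⟩ := hg
  exact ⟨.eqNum s t, fun x X => by simp only [Formula.Holds, hs, ht]⟩

instance RelDef.mem {f : NumFun n m} {F : StrFun n m} [hf : TermDef L f] [hF : StrTermDef L F] :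
    RelDef L (fun x X => f x X ∈ F x X) := by
  obtain ⟨s, hs⟩ := hf; obtain ⟨t, ht⟩ := hF
  exact ⟨.mem s t, fun x X => by simp only [Formula.Holds, hs, ht]⟩

instance RelDef.not {R : Rel n m} [hR : RelDef L R] : RelDef L (fun x X => ¬ R x X) := by
  obtain ⟨s, hs⟩ := hR
  exact ⟨.not s, fun x X => by simp only [Formula.Holds, hs]⟩

instance RelDef.and {R S : Rel n m} [hR : RelDef L R] [hS : RelDef L S] :
    RelDef L (fun x X => R x X ∧ S x X) := by
  obtain ⟨s, hs⟩ := hR; obtain ⟨t, ht⟩ := hS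
  exact ⟨.and s t, fun x X => by simp only [Formula.Holds, hs, ht]⟩

instance RelDef.or {R S : Rel n m} [hR : RelDef L R] [hS : RelDef L S] :
    RelDef L (fun x X => R x X ∨ S x X) := by
  obtain ⟨s, hs⟩ := hR; obtain ⟨t, ht⟩ := hS
  exact ⟨.or s t, fun x X => by simp only [Formula.Holds, hs, ht]⟩

instance (priority := low) RelDef.const (p : Prop) :
    RelDef L (fun (_ : Fin n → ℕ) (_ : Fin m → Str) => p) := by
  by_cases h : p
  · exact ⟨.eqNum .zero .zero, fun _ _ => by simp [Formula.Holds, h]⟩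
  · exact ⟨.eqNum .zero .one, fun _ _ => by simp [Formula.Holds, NumTerm.eval, h]⟩

/-- Bounded quantification; the quantified variable becomes variable `0` of the matrix. -/
instance RelDef.existsLE {f : NumFun n m} {P : (Fin n → ℕ) → ℕ → (Fin m → Str) → Prop}
    [hf : TermDef L f]
    [hP : RelDef L (fun (z : Fin (n + 1) → ℕ) X => P (fun j => z j.succ) (z 0) X)] :
    RelDef L (fun x X => ∃ y, y ≤ f x X ∧ P x y X) := by
  obtain ⟨s, hs⟩ := hf; obtain ⟨t, ht⟩ := hP
  exact ⟨.existsLE s t, fun x X => by simp [Formula.Holds, hs, ht]⟩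

instance RelDef.forallLE {f : NumFun n m} {P : (Fin n → ℕ) → ℕ → (Fin m → Str) → Prop}
    [hf : TermDef L f]
    [hP : RelDef L (fun (z : Fin (n + 1) → ℕ) X => P (fun j => z j.succ) (z 0) X)] :
    RelDef L (fun x X => ∀ y, y ≤ f x X → P x y X) := by
  obtain ⟨s, hs⟩ := hf; obtain ⟨t, ht⟩ := hP
  exact ⟨.forallLE s t, fun x X => by simp [Formula.Holds, hs, ht]⟩

theorem RelDef.congr {R S : Rel n m} (h : ∀ x X, R x X ↔ S x X) (hR : RelDef L R) :
    RelDef L S := by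
  obtain rfl : R = S := funext fun x => funext fun X => propext (h x X)
  exact hR

instance RelDef.existsLT {f : NumFun n m} {P : (Fin n → ℕ) → ℕ → (Fin m → Str) → Prop}
    [TermDef L f]
    [RelDef L (fun (z : Fin (n + 1) → ℕ) X => P (fun j => z j.succ) (z 0) X)] :
    RelDef L (fun x X => ∃ y, y < f x X ∧ P x y X) :=
  RelDef.congr (R := fun x X => ∃ y, y ≤ f x X ∧ y < f x X ∧ P x y X)
    (fun _ _ => ⟨fun ⟨y, _, h⟩ => ⟨y, h⟩, fun ⟨y, h⟩ => ⟨y, h.1.le, h⟩⟩) inferInstance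

/-- A disjunction over a finite index type is a `Σ₀ᴮ`-formula. -/
instance RelDef.existsFinite {ι : Type*} [Finite ι] {R : ι → Rel n m} [hR : ∀ i, RelDef L (R i)] :
    RelDef L (fun x X => ∃ i, R i x X) := by
  classical
  have key : ∀ s : Finset ι, RelDef L (fun x X => ∃ i ∈ s, R i x X) := fun s => by
    induction s using Finset.induction_on with
    | empty => exact RelDef.congr (R := fun _ _ => False) (by simp) inferInstance
    | insert i s _ ih =>
      exact RelDef.congr (R := fun x X => R i x X ∨ ∃ i ∈ s, R i x X) (by simp) inferInstance
  have := Fintype.ofFinite ι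
  exact RelDef.congr (by simp) (key Finset.univ)

theorem TermDef.polynomial (p : Polynomial ℕ) {f : NumFun n m} [TermDef L f] :
    TermDef L (fun x X => p.eval (f x X)) := by
  induction p using Polynomial.induction_on' with
  | add p q hp hq =>
    simp only [Polynomial.eval_add]
    infer_instance
  | monomial k c =>
    simp only [Polynomial.eval_monomial]
    induction k with
    | zero =>
      simp only [pow_zero]
      infer_instance
    | succ k ih =>
      simp only [pow_succ, ← mul_assoc]
      infer_instance

theorem TermDef.app {a b : ℕ} {f : NumFun a b} (hf : f ∈ L.num a b)
    {ts : (Fin n → ℕ) → (Fin m → Str) → Fin a → ℕ}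
    {Ts : (Fin n → ℕ) → (Fin m → Str) → Fin b → Str} (hts : ∀ i, TermDef L (fun x X => ts x X i))
    (hTs : ∀ i, StrTermDef L (fun x X => Ts x X i)) :
    TermDef L (fun x X => f (ts x X) (Ts x X)) := by
  choose t ht using fun i => (hts i).out
  choose T hT using fun i => (hTs i).out
  exact ⟨.app f hf t T, fun x X => by simp only [NumTerm.eval, ht, hT]⟩

theorem StrTermDef.app {a b : ℕ} {F : StrFun a b} (hF : F ∈ L.str a b)
    {ts : (Fin n → ℕ) → (Fin m → Str) → Fin a → ℕ}
    {Ts : (Fin n → ℕ) → (Fin m → Str) → Fin b → Str} (hts : ∀ i, TermDef L (fun x X => ts x X i))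
    (hTs : ∀ i, StrTermDef L (fun x X => Ts x X i)) :
    StrTermDef L (fun x X => F (ts x X) (Ts x X)) := by
  choose t ht using fun i => (hts i).out
  choose T hT using fun i => (hTs i).out
  exact ⟨.app F hF t T, fun x X => by simp only [StrTerm.eval, ht, hT]⟩

theorem RelDef.app {a b : ℕ} {R : Rel a b} (hR : R ∈ L.rel a b)
    {ts : (Fin n → ℕ) → (Fin m → Str) → Fin a → ℕ}
    {Ts : (Fin n → ℕ) → (Fin m → Str) → Fin b → Str} (hts : ∀ i, TermDef L (fun x X => ts x X i))
    (hTs : ∀ i, StrTermDef L (fun x X => Ts x X i)) :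
    RelDef L (fun x X => R (ts x X) (Ts x X)) := by
  choose t ht using fun i => (hts i).out
  choose T hT using fun i => (hTs i).out
  exact ⟨.rel R hR t T, fun x X => by simp only [Formula.Holds, ht, hT]⟩

theorem RelDef.eqStr {F G : StrFun n m} (hF : StrTermDef L F) (hG : StrTermDef L G) :
    RelDef L (fun x X => F x X = G x X) := by
  obtain ⟨s, hs⟩ := hF; obtain ⟨t, ht⟩ := hG
  exact ⟨.eqStr s t, fun x X => by simp only [Formula.Holds, hs, ht]⟩

instance TermDef.pair {f g : NumFun n m} [TermDef L f] [TermDef L g] :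
    TermDef L (fun x X => pair (f x X) (g x X)) := by
  unfold TwoSorted.pair; infer_instance

end

/-! ### Polynomial bounds -/

/-- `f` is bounded by a polynomial in the number arguments and the lengths of the string
arguments. -/
class PolyBounded {a b : ℕ} (f : NumFun a b) : Prop where
  out : NumPBounded f

section
variable {a b : ℕ}

instance PolyBounded.var (i : Fin a) : PolyBounded (fun x (_ : Fin b → Str) => x i) :=
  ⟨.X (.inl i), fun _ _ => by simp⟩

instance PolyBounded.len (i : Fin b) : PolyBounded (fun (_ : Fin a → ℕ) X => len (X i)) :=
  ⟨.X (.inr i), fun _ _ => by simp⟩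

instance (priority := low) PolyBounded.const (c : ℕ) :
    PolyBounded (fun (_ : Fin a → ℕ) (_ : Fin b → Str) => c) :=
  ⟨.C c, fun _ _ => by simp⟩

instance PolyBounded.add {f g : NumFun a b} [hf : PolyBounded f] [hg : PolyBounded g] :
    PolyBounded (fun x X => f x X + g x X) := by
  obtain ⟨p, hp⟩ := hf; obtain ⟨q, hq⟩ := hg
  exact ⟨p + q, fun x X => by simpa using Nat.add_le_add (hp x X) (hq x X)⟩

instance PolyBounded.mul {f g : NumFun a b} [hf : PolyBounded f] [hg : PolyBounded g] :
    PolyBounded (fun x X => f x X * g x X) := by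
  obtain ⟨p, hp⟩ := hf; obtain ⟨q, hq⟩ := hg
  exact ⟨p * q, fun x X => by simpa using Nat.mul_le_mul (hp x X) (hq x X)⟩

instance PolyBounded.sum {k : ℕ} {f : Fin k → NumFun a b} [hf : ∀ i, PolyBounded (f i)] :
    PolyBounded (fun x X => ∑ i, f i x X) := by
  induction k with
  | zero =>
    simp only [Finset.univ_eq_empty, Finset.sum_empty]
    infer_instance
  | succ k ih =>
    simp only [Fin.sum_univ_succ]
    infer_instance

theorem PolyBounded.polynomial (p : Polynomial ℕ) {f : NumFun a b} [PolyBounded f] :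
    PolyBounded (fun x X => p.eval (f x X)) := by
  induction p using Polynomial.induction_on' with
  | add p q hp hq =>
    simp only [Polynomial.eval_add]
    infer_instance
  | monomial k c =>
    simp only [Polynomial.eval_monomial]
    induction k with
    | zero =>
      simp only [pow_zero]
      infer_instance
    | succ k ih =>
      simp only [pow_succ, ← mul_assoc]
      infer_instance

instance PolyBounded.pair {f g : NumFun a b} [PolyBounded f] [PolyBounded g] :
    PolyBounded (fun x X => pair (f x X) (g x X)) := by
  unfold TwoSorted.pair; infer_instance

end

/-! ### Strings and the pairing function -/

theorem lt_len {i : ℕ} {X : Str} (h : i ∈ X) : i < len X :=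
  Nat.succ_le_iff.1 (Finset.le_sup (f := fun i => i + 1) h)

theorem len_le {X : Str} {k : ℕ} (h : ∀ i ∈ X, i < k) : len X ≤ k :=
  Finset.sup_le fun i hi => h i hi

theorem exists_mem_of_lt_len {X : Str} {k : ℕ} (h : k < len X) : ∃ i ∈ X, k ≤ i := by
  obtain ⟨i, hi, h⟩ := (Finset.lt_sup_iff).1 h
  exact ⟨i, hi, Nat.lt_succ_iff.1 h⟩

theorem le_pair_left (x y : ℕ) : x ≤ pair x y := by unfold pair; nlinarith

theorem le_pair_right (x y : ℕ) : y ≤ pair x y := by unfold pair; nlinarith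

theorem pair_le_pair {x y x' y' : ℕ} (hx : x ≤ x') (hy : y ≤ y') : pair x y ≤ pair x' y' := by
  unfold pair; gcongr

theorem pair_inj {x y x' y' : ℕ} : pair x y = pair x' y' ↔ x = x' ∧ y = y' := by
  refine ⟨fun h => ?_, fun h => by rw [h.1, h.2]⟩
  unfold pair at h
  rcases lt_trichotomy (x + y) (x' + y') with hlt | heq | hlt
  · nlinarith
  · rw [heq] at h; omega
  · nlinarith

/-! ### Closure of reducibility -/

/-- Definability of a string function from a bound and a definition of its bit graph. The variable
`0` is the index of the bit. -/
theorem StrDefinable.of_relDef {L : Collection} {a b : ℕ} {F : StrFun a b}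
    (bound : NumFun a b) [hb : PolyBounded bound] (h : ∀ x X, ∀ i ∈ F x X, i < bound x X)
    (hR : RelDef L (fun (z : Fin (a + 1) → ℕ) X => z 0 ∈ F (fun j => z j.succ) X)) :
    StrDefinable L F := by
  obtain ⟨p, hp⟩ := hb
  obtain ⟨φ, hφ⟩ := hR
  exact ⟨⟨p, fun x X => (len_le (h x X)).trans (hp x X)⟩, φ, fun i x X => by simp [hφ]⟩

/-- A string function together with the numbers of its arguments. -/
abbrev StrSym : Type := Σ a b : ℕ, StrFun a b

/-- `L'` has the number functions and relations of `L` and the string functions in the list. -/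
def Collection.Supports (L' L : Collection) (Ss : List StrSym) : Prop :=
  (∀ a b, L.num a b ⊆ L'.num a b) ∧ (∀ a b, L.rel a b ⊆ L'.rel a b) ∧
    ∀ S ∈ Ss, S.2.2 ∈ L'.str S.1 S.2.1

theorem Collection.Supports.mono {L' L : Collection} {Ss Ts : List StrSym}
    (h : L'.Supports L Ss) (hT : ∀ T ∈ Ts, T ∈ Ss) : L'.Supports L Ts :=
  ⟨h.1, h.2.1, fun T hT' => h.2.2 T (hT T hT')⟩

section
variable {L : Collection} {n m : ℕ}

mutual
/-- The string functions that occur in a number term. -/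
def NumTerm.syms : NumTerm L n m → List StrSym
  | .var _ => []
  | .zero => []
  | .one => []
  | .add s t => s.syms ++ t.syms
  | .mul s t => s.syms ++ t.syms
  | .len T => T.syms
  | .app _ _ ts Ts =>
    (List.ofFn fun i => (ts i).syms).flatten ++ (List.ofFn fun i => (Ts i).syms).flatten

/-- The string functions that occur in a string term. -/
def StrTerm.syms : StrTerm L n m → List StrSym
  | .var _ => []
  | @StrTerm.app _ _ _ a b F _ ts Ts => ⟨a, b, F⟩ ::
    ((List.ofFn fun i => (ts i).syms).flatten ++ (List.ofFn fun i => (Ts i).syms).flatten)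
end

/-- The string functions that occur in a formula. -/
def Formula.syms : {n : ℕ} → Formula L m n → List StrSym
  | _, .eqNum s t => s.syms ++ t.syms
  | _, .leNum s t => s.syms ++ t.syms
  | _, .eqStr S T => S.syms ++ T.syms
  | _, .mem t T => t.syms ++ T.syms
  | _, .rel _ _ ts Ts =>
    (List.ofFn fun i => (ts i).syms).flatten ++ (List.ofFn fun i => (Ts i).syms).flatten
  | _, .not φ => φ.syms
  | _, .and φ ψ => φ.syms ++ ψ.syms
  | _, .or φ ψ => φ.syms ++ ψ.syms
  | _, .existsLE t φ => t.syms ++ φ.syms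
  | _, .forallLE t φ => t.syms ++ φ.syms

theorem mem_flatten_ofFn {α : Type*} {k : ℕ} {f : Fin k → List α} (i : Fin k) {s : α}
    (h : s ∈ f i) : s ∈ (List.ofFn f).flatten :=
  List.mem_flatten.2 ⟨f i, by simp, h⟩

mutual
theorem NumTerm.syms_mem : ∀ t : NumTerm L n m, ∀ S ∈ t.syms, S.2.2 ∈ L.str S.1 S.2.1
  | .var i, S, h => by simp [NumTerm.syms] at h
  | .zero, S, h => by simp [NumTerm.syms] at h
  | .one, S, h => by simp [NumTerm.syms] at h
  | .add s t, S, h => by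
    rw [NumTerm.syms, List.mem_append] at h
    exact h.elim (NumTerm.syms_mem s S) (NumTerm.syms_mem t S)
  | .mul s t, S, h => by
    rw [NumTerm.syms, List.mem_append] at h
    exact h.elim (NumTerm.syms_mem s S) (NumTerm.syms_mem t S)
  | .len T, S, h => by
    rw [NumTerm.syms] at h
    exact StrTerm.syms_mem T S h
  | .app f hf ts Ts, S, h => by
    simp only [NumTerm.syms, List.mem_append, List.mem_flatten, List.mem_ofFn] at h
    rcases h with ⟨_, ⟨i, rfl⟩, h⟩ | ⟨_, ⟨i, rfl⟩, h⟩
    · exact NumTerm.syms_mem (ts i) S h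
    · exact StrTerm.syms_mem (Ts i) S h

theorem StrTerm.syms_mem : ∀ T : StrTerm L n m, ∀ S ∈ T.syms, S.2.2 ∈ L.str S.1 S.2.1
  | .var i, S, h => by simp [StrTerm.syms] at h
  | .app F hF ts Ts, S, h => by
    simp only [StrTerm.syms, List.mem_cons, List.mem_append, List.mem_flatten,
      List.mem_ofFn] at h
    rcases h with rfl | ⟨_, ⟨i, rfl⟩, h⟩ | ⟨_, ⟨i, rfl⟩, h⟩
    · exact hF
    · exact NumTerm.syms_mem (ts i) S h
    · exact StrTerm.syms_mem (Ts i) S h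
end

theorem Formula.syms_mem : ∀ {n : ℕ} (φ : Formula L m n), ∀ S ∈ φ.syms, S.2.2 ∈ L.str S.1 S.2.1
  | _, .eqNum s t, S, h => (List.mem_append.1 h).elim (s.syms_mem S) (t.syms_mem S)
  | _, .leNum s t, S, h => (List.mem_append.1 h).elim (s.syms_mem S) (t.syms_mem S)
  | _, .eqStr s t, S, h => (List.mem_append.1 h).elim (s.syms_mem S) (t.syms_mem S)
  | _, .mem s t, S, h => (List.mem_append.1 h).elim (s.syms_mem S) (t.syms_mem S)
  | _, .rel R hR ts Ts, S, h => by
    simp only [Formula.syms, List.mem_append, List.mem_flatten, List.mem_ofFn] at h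
    rcases h with ⟨_, ⟨i, rfl⟩, h⟩ | ⟨_, ⟨i, rfl⟩, h⟩
    · exact (ts i).syms_mem S h
    · exact (Ts i).syms_mem S h
  | _, .not φ, S, h => φ.syms_mem S h
  | _, .and φ ψ, S, h => (List.mem_append.1 h).elim (φ.syms_mem S) (ψ.syms_mem S)
  | _, .or φ ψ, S, h => (List.mem_append.1 h).elim (φ.syms_mem S) (ψ.syms_mem S)
  | _, .existsLE t φ, S, h => (List.mem_append.1 h).elim (t.syms_mem S) (φ.syms_mem S)
  | _, .forallLE t φ, S, h => (List.mem_append.1 h).elim (t.syms_mem S) (φ.syms_mem S)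

mutual
theorem NumTerm.termDef_of_supports {L' : Collection} :
    ∀ t : NumTerm L n m, L'.Supports L t.syms → TermDef L' (fun x X => t.eval x X)
  | .var i, _ => by simp only [NumTerm.eval]; infer_instance
  | .zero, _ => by simp only [NumTerm.eval]; infer_instance
  | .one, _ => by simp only [NumTerm.eval]; infer_instance
  | .add s t, h => by
    have := NumTerm.termDef_of_supports s (h.mono fun S hS => by simp [NumTerm.syms, hS])
    have := NumTerm.termDef_of_supports t (h.mono fun S hS => by simp [NumTerm.syms, hS])
    simp only [NumTerm.eval]; infer_instance
  | .mul s t, h => by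
    have := NumTerm.termDef_of_supports s (h.mono fun S hS => by simp [NumTerm.syms, hS])
    have := NumTerm.termDef_of_supports t (h.mono fun S hS => by simp [NumTerm.syms, hS])
    simp only [NumTerm.eval]; infer_instance
  | .len T, h => by
    have := StrTerm.strTermDef_of_supports T (h.mono fun S hS => by simp [NumTerm.syms, hS])
    simp only [NumTerm.eval]; infer_instance
  | .app f hf ts Ts, h => by
    simp only [NumTerm.eval]
    exact TermDef.app (h.1 _ _ hf)
      (fun i => NumTerm.termDef_of_supports (ts i) (h.mono fun S hS => by
        rw [NumTerm.syms]; exact List.mem_append_left _ (mem_flatten_ofFn i hS)))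
      (fun i => StrTerm.strTermDef_of_supports (Ts i) (h.mono fun S hS => by
        rw [NumTerm.syms]; exact List.mem_append_right _ (mem_flatten_ofFn i hS)))

theorem StrTerm.strTermDef_of_supports {L' : Collection} :
    ∀ T : StrTerm L n m, L'.Supports L T.syms → StrTermDef L' (fun x X => T.eval x X)
  | .var i, _ => by simp only [StrTerm.eval]; infer_instance
  | .app F hF ts Ts, h => by
    simp only [StrTerm.eval]
    exact StrTermDef.app (h.2.2 ⟨_, _, F⟩ (by simp [StrTerm.syms]))
      (fun i => NumTerm.termDef_of_supports (ts i) (h.mono fun S hS => by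
        rw [StrTerm.syms]
        exact List.mem_cons_of_mem _ (List.mem_append_left _ (mem_flatten_ofFn i hS))))
      (fun i => StrTerm.strTermDef_of_supports (Ts i) (h.mono fun S hS => by
        rw [StrTerm.syms]
        exact List.mem_cons_of_mem _ (List.mem_append_right _ (mem_flatten_ofFn i hS))))
end

/-- A formula over `L` can be read over every collection that contains the symbols occurring
in it. -/
theorem Formula.relDef_of_supports {L' : Collection} :
    ∀ {n : ℕ} (φ : Formula L m n), L'.Supports L φ.syms → RelDef L' (fun x X => φ.Holds X x)
  | _, .eqNum s t, h => by
    have := s.termDef_of_supports (h.mono fun S hS => List.mem_append_left _ hS)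
    have := t.termDef_of_supports (h.mono fun S hS => List.mem_append_right _ hS)
    simp only [Formula.Holds]; infer_instance
  | _, .leNum s t, h => by
    have := s.termDef_of_supports (h.mono fun S hS => List.mem_append_left _ hS)
    have := t.termDef_of_supports (h.mono fun S hS => List.mem_append_right _ hS)
    simp only [Formula.Holds]; infer_instance
  | _, .eqStr s t, h => by
    simp only [Formula.Holds]
    exact RelDef.eqStr (s.strTermDef_of_supports (h.mono fun S hS => List.mem_append_left _ hS))
      (t.strTermDef_of_supports (h.mono fun S hS => List.mem_append_right _ hS))
  | _, .mem s t, h => by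
    have := s.termDef_of_supports (h.mono fun S hS => List.mem_append_left _ hS)
    have := t.strTermDef_of_supports (h.mono fun S hS => List.mem_append_right _ hS)
    simp only [Formula.Holds]; infer_instance
  | _, .rel R hR ts Ts, h => by
    simp only [Formula.Holds]
    exact RelDef.app (h.2.1 _ _ hR)
      (fun i => (ts i).termDef_of_supports (h.mono fun S hS =>
        List.mem_append_left _ (mem_flatten_ofFn i hS)))
      (fun i => (Ts i).strTermDef_of_supports (h.mono fun S hS =>
        List.mem_append_right _ (mem_flatten_ofFn i hS)))
  | _, .not φ, h => by
    have := φ.relDef_of_supports h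
    simp only [Formula.Holds]; infer_instance
  | _, .and φ ψ, h => by
    have := φ.relDef_of_supports (h.mono fun S hS => List.mem_append_left _ hS)
    have := ψ.relDef_of_supports (h.mono fun S hS => List.mem_append_right _ hS)
    simp only [Formula.Holds]; infer_instance
  | _, .or φ ψ, h => by
    have := φ.relDef_of_supports (h.mono fun S hS => List.mem_append_left _ hS)
    have := ψ.relDef_of_supports (h.mono fun S hS => List.mem_append_right _ hS)
    simp only [Formula.Holds]; infer_instance
  | n, .existsLE t φ, h => by
    have := t.termDef_of_supports (h.mono fun S hS => List.mem_append_left _ hS)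
    obtain ⟨ψ, hψ⟩ := φ.relDef_of_supports (h.mono fun S hS => List.mem_append_right _ hS)
    simp only [Formula.Holds]
    refine @RelDef.existsLE _ _ _ _ (fun x y X => φ.Holds X (Fin.cons y x : Fin (n + 1) → ℕ)) _
      ⟨ψ, fun z X => ?_⟩
    rw [hψ, ← Fin.cons_self_tail z]; rfl
  | n, .forallLE t φ, h => by
    have := t.termDef_of_supports (h.mono fun S hS => List.mem_append_left _ hS)
    obtain ⟨ψ, hψ⟩ := φ.relDef_of_supports (h.mono fun S hS => List.mem_append_right _ hS)
    simp only [Formula.Holds]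
    refine @RelDef.forallLE _ _ _ _ (fun x y X => φ.Holds X (Fin.cons y x : Fin (n + 1) → ℕ)) _
      ⟨ψ, fun z X => ?_⟩
    rw [hψ, ← Fin.cons_self_tail z]; rfl

theorem StrDefinable.mono {L' : Collection} {a b : ℕ} {F : StrFun a b} (h : StrDefinable L F)
    (hn : ∀ a b, L.num a b ⊆ L'.num a b) (hr : ∀ a b, L.rel a b ⊆ L'.rel a b)
    (hs : ∀ a b, L.str a b ⊆ L'.str a b) : StrDefinable L' F := by
  obtain ⟨hb, φ, hφ⟩ := h
  obtain ⟨ψ, hψ⟩ := φ.relDef_of_supports ⟨hn, hr, fun S hS => hs _ _ (φ.syms_mem S hS)⟩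
  exact ⟨hb, ψ, fun i x X => (hψ _ _).trans (hφ i x X)⟩

theorem DefinableSeq.append {As Bs : List StrSym} (hA : DefinableSeq L As)
    (hB : DefinableSeq L Bs) : DefinableSeq L (As ++ Bs) := by
  induction As with
  | nil => exact hB
  | cons A As ih =>
    refine ⟨hA.1.mono (fun _ _ => subset_rfl) (fun _ _ => subset_rfl) fun a b => ?_, ih hA.2⟩
    exact Set.union_subset_union_right _ fun F hF => List.mem_append_left _ hF

/-- Finitely many string functions that occur in definable sequences occur together in one. -/
theorem DefinableSeq.exists_common (Ss : List StrSym)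
    (h : ∀ S ∈ Ss, ∃ Gs, DefinableSeq L Gs ∧ S ∈ Gs) :
    ∃ Gs, DefinableSeq L Gs ∧ ∀ S ∈ Ss, S ∈ Gs := by
  induction Ss with
  | nil => exact ⟨[], trivial, by simp⟩
  | cons S Ss ih =>
    obtain ⟨Gs, hG, hS⟩ := ih fun T hT => h T (List.mem_cons_of_mem _ hT)
    obtain ⟨Gs', hG', hS'⟩ := h S List.mem_cons_self
    refine ⟨Gs' ++ Gs, hG'.append hG, fun T hT => ?_⟩
    rcases List.mem_cons.1 hT with rfl | hT
    · exact List.mem_append_left _ hS'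
    · exact List.mem_append_right _ (hS T hT)

end

section
variable {L L' : Collection}

/-- A formula over `L` and the functions `Fs` can be read over `L'` and a definable sequence, if
every string function of `L` occurs in a definable sequence over `L'`. -/
theorem Formula.exists_definableSeq {m n : ℕ} {Fs Gs : List StrSym}
    (hn : ∀ a b, L.num a b ⊆ L'.num a b) (hr : ∀ a b, L.rel a b ⊆ L'.rel a b)
    (hL : ∀ a b, ∀ F ∈ L.str a b, ∃ Gs, DefinableSeq L' Gs ∧ (⟨a, b, F⟩ : StrSym) ∈ Gs)
    (hG : DefinableSeq L' Gs) (hF : ∀ F ∈ Fs, F ∈ Gs) (φ : Formula (L.adjoin Fs) m n) :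
    ∃ Gs', DefinableSeq L' Gs' ∧ (∀ G ∈ Gs, G ∈ Gs') ∧
      RelDef (L'.adjoin Gs') (fun x X => φ.Holds X x) := by
  obtain ⟨Gs', hG', hS⟩ := DefinableSeq.exists_common (L := L') φ.syms fun S hS => by
    rcases φ.syms_mem S hS with h | h
    · exact hL _ _ _ h
    · exact ⟨Gs, hG, hF S h⟩
  refine ⟨Gs' ++ Gs, hG'.append hG, fun G h => List.mem_append_right _ h,
    φ.relDef_of_supports ⟨hn, hr, fun S h => Or.inr (List.mem_append_left _ (hS S h))⟩⟩

theorem DefinableSeq.translate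
    (hn : ∀ a b, L.num a b ⊆ L'.num a b) (hr : ∀ a b, L.rel a b ⊆ L'.rel a b)
    (hL : ∀ a b, ∀ F ∈ L.str a b, ∃ Gs, DefinableSeq L' Gs ∧ (⟨a, b, F⟩ : StrSym) ∈ Gs)
    {Fs : List StrSym} (hF : DefinableSeq L Fs) :
    ∃ Gs, DefinableSeq L' Gs ∧ ∀ F ∈ Fs, F ∈ Gs := by
  induction Fs with
  | nil => exact ⟨[], trivial, by simp⟩
  | cons F Fs ih =>
    obtain ⟨Gs, hG, hsub⟩ := ih hF.2
    obtain ⟨hb, φ, hφ⟩ := hF.1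
    obtain ⟨Gs', hG', hsub', ψ, hψ⟩ := φ.exists_definableSeq hn hr hL hG hsub
    refine ⟨F :: Gs', ⟨⟨hb, ψ, fun i x X => (hψ _ _).trans (hφ i x X)⟩, hG'⟩, fun S hS => ?_⟩
    rcases List.mem_cons.1 hS with rfl | hS
    · exact List.mem_cons_self
    · exact List.mem_cons_of_mem _ (hsub' _ (hsub _ hS))

/-- Reducibility to `L` implies reducibility to `L'`, if every string function of `L` occurs in a
definable sequence over `L'`. -/
theorem StrReducible.trans {a b : ℕ} {F : StrFun a b} (h : StrReducible F L)
    (hn : ∀ a b, L.num a b ⊆ L'.num a b) (hr : ∀ a b, L.rel a b ⊆ L'.rel a b)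
    (hL : ∀ a b, ∀ F ∈ L.str a b, ∃ Gs, DefinableSeq L' Gs ∧ (⟨a, b, F⟩ : StrSym) ∈ Gs) :
    StrReducible F L' := by
  obtain ⟨Fs, hF, hb, φ, hφ⟩ := h
  obtain ⟨Gs, hG, hsub⟩ := hF.translate hn hr hL
  obtain ⟨Gs', hG', _, ψ, hψ⟩ := φ.exists_definableSeq hn hr hL hG hsub
  exact ⟨Gs', hG', hb, ψ, fun i x X => (hψ _ _).trans (hφ i x X)⟩

theorem NumReducible.trans {a b : ℕ} {f : NumFun a b} (h : NumReducible f L)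
    (hn : ∀ a b, L.num a b ⊆ L'.num a b) (hr : ∀ a b, L.rel a b ⊆ L'.rel a b)
    (hL : ∀ a b, ∀ F ∈ L.str a b, ∃ Gs, DefinableSeq L' Gs ∧ (⟨a, b, F⟩ : StrSym) ∈ Gs) :
    NumReducible f L' := by
  obtain ⟨Fs, hF, hb, φ, hφ⟩ := h
  obtain ⟨Gs, hG, hsub⟩ := hF.translate hn hr hL
  obtain ⟨Gs', hG', _, ψ, hψ⟩ := φ.exists_definableSeq hn hr hL hG hsub
  exact ⟨Gs', hG', hb, ψ, fun i x X => (hψ _ _).trans (hφ i x X)⟩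

end

/-! ### Counting accepting paths -/

section
variable {α : Type*} (r : α → α → Prop) (acc : Set α)

/-- The accepting paths of the transition relation `r` that start in `c`. -/
def accPaths (c : α) : Set (List α) :=
  {p | (p.head? = some c ∧ p.IsChain r) ∧
    ∃ e, p.getLast? = some e ∧ e ∈ acc ∧ ∀ e', ¬ r e e'}

/-- Every path of `r` that starts in `c` has at most `t` configurations, all of which satisfy
`good`. -/
def PathsWithin (good : α → Prop) (c : α) (t : ℕ) : Prop :=
  ∀ p : List α, p.head? = some c → p.IsChain r → p.length ≤ t ∧ ∀ k ∈ p, good k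

variable {r acc}

theorem eq_singleton_of_halt {c : α} (h : ∀ c', ¬ r c c') {p : List α}
    (hp : p.head? = some c) (hc : p.IsChain r) : p = [c] := by
  match p, hp, hc with
  | [a], hp, _ => simp_all
  | a :: b :: p, hp, hc =>
    obtain rfl : a = c := by simpa using hp
    exact absurd (List.isChain_cons_cons.1 hc).1 (h b)

theorem accPaths_of_halt_of_mem {c : α} (h : ∀ c', ¬ r c c') (hc : c ∈ acc) :
    accPaths r acc c = {[c]} := by
  ext p
  constructor
  · rintro ⟨⟨hp, hch⟩, -⟩
    exact eq_singleton_of_halt h hp hch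
  · rintro rfl
    exact ⟨⟨rfl, List.isChain_singleton c⟩, c, rfl, hc, h⟩

theorem accPaths_of_halt_of_notMem {c : α} (h : ∀ c', ¬ r c c') (hc : c ∉ acc) :
    accPaths r acc c = ∅ := by
  refine Set.eq_empty_of_forall_notMem ?_
  rintro p ⟨⟨hp, hch⟩, e, he, hacc, -⟩
  obtain rfl := eq_singleton_of_halt h hp hch
  obtain rfl : c = e := by simpa using he
  exact hc hacc

theorem accPaths_of_step {c c₁ : α} (h : r c c₁) :
    accPaths r acc c = ⋃ c' ∈ {c' | r c c'}, (c :: ·) '' accPaths r acc c' := by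
  ext p
  simp only [Set.mem_iUnion, Set.mem_image, Set.mem_ofPred_eq, exists_prop]
  constructor
  · rintro ⟨⟨hp, hch⟩, e, he, hacc⟩
    match p, hp, hch, he with
    | [a], hp, _, he =>
      obtain rfl : a = c := by simpa using hp
      obtain rfl : a = e := by simpa using he
      exact absurd h (hacc.2 _)
    | a :: b :: p, hp, hch, he =>
      obtain rfl : a = c := by simpa using hp
      rw [List.isChain_cons_cons] at hch
      exact ⟨b, hch.1, b :: p, ⟨⟨rfl, hch.2⟩, e, by simpa using he, hacc⟩, rfl⟩
  · rintro ⟨c', hr, q, ⟨⟨hq, hch⟩, e, he, hacc⟩, rfl⟩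
    match q, hq, hch, he with
    | b :: q, hq, hch, he =>
      obtain rfl : b = c' := by simpa using hq
      exact ⟨⟨rfl, List.isChain_cons_cons.2 ⟨hr, hch⟩⟩, e, by simpa using he, hacc⟩

/-- The number of accepting paths from a configuration with successors is the sum of the numbers
for its successors. -/
theorem encard_accPaths_of_step {c : α} {S : Finset α} (hS : ∀ c', r c c' ↔ c' ∈ S)
    (hne : S.Nonempty) :
    (accPaths r acc c).encard = ∑ c' ∈ S, (accPaths r acc c').encard := by
  obtain ⟨c₁, hc₁⟩ := hne
  have hset : {c' | r c c'} = (S : Set α) := Set.ext fun c' => hS c'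
  rw [accPaths_of_step ((hS c₁).2 hc₁), hset, Set.Finite.encard_biUnion S.finite_toSet,
    finsum_mem_coe_finset]
  · exact Finset.sum_congr rfl fun c' _ => Set.InjOn.encard_image List.cons_injective.injOn
  · intro a _ b _ hab
    refine Set.disjoint_left.2 ?_
    rintro _ ⟨p, hp, rfl⟩ ⟨q, hq, hqp⟩
    obtain rfl : q = p := List.cons_injective hqp
    exact hab (Option.some_injective _ (hp.1.1.symm.trans hq.1.1))

theorem PathsWithin.of_halt {good : α → Prop} {c : α} (h : ∀ c', ¬ r c c') (hg : good c) :
    PathsWithin r good c 1 := by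
  intro p hp hch
  obtain rfl := eq_singleton_of_halt h hp hch
  simpa using hg

theorem PathsWithin.of_step {good : α → Prop} {c : α} {t : ℕ} (hg : good c)
    (h : ∀ c', r c c' → PathsWithin r good c' t) : PathsWithin r good c (t + 1) := by
  intro p hp hch
  match p, hp, hch with
  | [a], hp, _ =>
    obtain rfl : a = c := by simpa using hp
    simpa using hg
  | a :: b :: p, hp, hch =>
    obtain rfl : a = c := by simpa using hp
    rw [List.isChain_cons_cons] at hch
    obtain ⟨h₁, h₂⟩ := h b hch.1 (b :: p) rfl hch.2
    exact ⟨Nat.succ_le_succ h₁, by simpa [hg] using h₂⟩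

theorem PathsWithin.mono {good : α → Prop} {c : α} {t t' : ℕ} (h : PathsWithin r good c t)
    (ht : t ≤ t') : PathsWithin r good c t' :=
  fun p hp hch => ⟨(h p hp hch).1.trans ht, (h p hp hch).2⟩

theorem PathsWithin.pos {good : α → Prop} {c : α} {t : ℕ} (h : PathsWithin r good c t) : 0 < t :=
  (h [c] rfl (List.isChain_singleton c)).1

theorem PathsWithin.step {good : α → Prop} {c c' : α} {t : ℕ} (h : PathsWithin r good c (t + 1))
    (hr : r c c') : PathsWithin r good c' t := by
  intro p hp hch
  match p, hp, hch with
  | b :: p, hp, hch =>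
    obtain rfl : b = c' := by simpa using hp
    obtain ⟨h₁, h₂⟩ := h (c :: b :: p) rfl (List.isChain_cons_cons.2 ⟨hr, hch⟩)
    exact ⟨Nat.succ_le_succ_iff.1 h₁, fun k hk => h₂ k (List.mem_cons_of_mem _ hk)⟩

end

/-! ### Accepting paths and matrix powers -/

section
open Classical

/-- The `0`-`1` adjacency matrix of the relation `E` on the numbers below `N`. -/
noncomputable def adjMatrix (E : ℕ → ℕ → Prop) (N : ℕ) : Matrix (Fin N) (Fin N) ℕ :=
  Matrix.of fun u v => if E u v then 1 else 0

/-- The number of walks with `k` edges from `u` to `0` along `E` in the numbers below `N`. -/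
noncomputable def walkCount (E : ℕ → ℕ → Prop) (N : ℕ) : ℕ → ℕ → ℕ
  | 0, u => if u = 0 then 1 else 0
  | k + 1, u => ∑ v ∈ (Finset.range N).filter (E u), walkCount E N k v

theorem adjMatrix_pow_apply (E : ℕ → ℕ → Prop) {N : ℕ} (hN : 0 < N) (k : ℕ) (u : Fin N) :
    (adjMatrix E N ^ k) u ⟨0, hN⟩ = walkCount E N k u := by
  induction k generalizing u with
  | zero => simp [walkCount, Matrix.one_apply, Fin.ext_iff]
  | succ k ih =>
    rw [pow_succ', Matrix.mul_apply, walkCount, Finset.sum_filter,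
      ← Fin.sum_univ_eq_sum_range (fun v => if E u v then walkCount E N k v else 0)]
    exact Finset.sum_congr rfl fun v _ => by rw [ih]; simp [adjMatrix]

theorem walkCount_le (E : ℕ → ℕ → Prop) (N k u : ℕ) : walkCount E N k u ≤ N ^ k := by
  induction k generalizing u with
  | zero => rw [walkCount]; split_ifs <;> simp
  | succ k ih =>
    rw [walkCount]
    refine (Finset.sum_le_card_nsmul _ _ _ fun v _ => ih v).trans ?_
    rw [smul_eq_mul, pow_succ']
    exact Nat.mul_le_mul_right _ ((Finset.card_filter_le _ _).trans_eq (Finset.card_range N))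

/-- If `code` embeds the configurations reachable from `c` into the numbers below `N` in such a way
that `E` is the transition relation, extended by edges from the accepting halting configurations
to the sink `0` and by a loop at the sink, then accepting paths are counted by walks to the sink. -/
theorem encard_accPaths_eq_walkCount {α : Type*} {r : α → α → Prop} {acc : Set α}
    {good G : α → Prop} {code : α → ℕ} {E : ℕ → ℕ → Prop} {N : ℕ} (hN : 0 < N)
    (hG : ∀ c c', G c → r c c' → G c') (hlt : ∀ c, G c → code c < N)
    (hinj : ∀ c c', G c → G c' → code c = code c' → c = c')
    (hE : ∀ c, G c → ∀ v < N, E (code c) v ↔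
      (∃ c', r c c' ∧ v = code c') ∨ (v = 0 ∧ c ∈ acc ∧ ∀ c', ¬ r c c'))
    (hE0 : ∀ v < N, E 0 v ↔ v = 0) {k : ℕ} {c : α} (hc : G c) (hk : PathsWithin r good c k) :
    (accPaths r acc c).encard = walkCount E N k (code c) := by
  have hsink : ∀ k, walkCount E N k 0 = 1 := by
    intro k
    induction k with
    | zero => rfl
    | succ k ih =>
      have : (Finset.range N).filter (E 0) = {0} := by
        ext v
        simp only [Finset.mem_filter, Finset.mem_range, Finset.mem_singleton]
        exact ⟨fun h => (hE0 v h.1).1 h.2, by rintro rfl; exact ⟨hN, (hE0 0 hN).2 rfl⟩⟩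
      rw [walkCount, this, Finset.sum_singleton, ih]
  induction k generalizing c with
  | zero => exact absurd hk.pos (lt_irrefl 0)
  | succ k ih =>
    by_cases hhalt : ∀ c', ¬ r c c'
    · -- a halting configuration: the only edge that may leave it leads to the sink
      by_cases hacc : c ∈ acc
      · have : (Finset.range N).filter (E (code c)) = {0} := by
          ext v
          simp only [Finset.mem_filter, Finset.mem_range, Finset.mem_singleton]
          constructor
          · rintro ⟨hv, hv'⟩
            rcases (hE c hc v hv).1 hv' with ⟨c', h, -⟩ | h
            · exact absurd h (hhalt c')
            · exact h.1
          · rintro rfl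
            exact ⟨hN, (hE c hc 0 hN).2 (Or.inr ⟨rfl, hacc, hhalt⟩)⟩
        rw [accPaths_of_halt_of_mem hhalt hacc, walkCount, this, Finset.sum_singleton, hsink]
        simp
      · have : (Finset.range N).filter (E (code c)) = ∅ := by
          refine Finset.filter_eq_empty_iff.2 fun v hv hv' => ?_
          rcases (hE c hc v (Finset.mem_range.1 hv)).1 hv' with ⟨c', h, -⟩ | h
          · exact hhalt c' h
          · exact hacc h.2.1
        rw [accPaths_of_halt_of_notMem hhalt hacc, walkCount, this]
        simp
    · -- the edges that leave it lead to its successors, and `code` is injective on these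
      push Not at hhalt
      have hinjOn : Set.InjOn code {c' | r c c'} := fun a ha b hb hab =>
        hinj a b (hG c a hc ha) (hG c b hc hb) hab
      have hfin : {c' | r c c'}.Finite := by
        refine Set.Finite.of_finite_image ((Set.finite_lt_nat N).subset ?_) hinjOn
        rintro _ ⟨a, ha, rfl⟩
        exact hlt a (hG c a hc ha)
      have hmem : ∀ c', r c c' ↔ c' ∈ hfin.toFinset := fun c' => by simp
      rw [encard_accPaths_of_step hmem (by simpa [Set.Nonempty] using hhalt),
        Finset.sum_congr rfl fun c' hc' => ih (hG c c' hc ((hmem c').2 hc'))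
          (hk.step ((hmem c').2 hc')), walkCount]
      have : (Finset.range N).filter (E (code c)) = hfin.toFinset.image code := by
        ext v
        simp only [Finset.mem_filter, Finset.mem_range, Finset.mem_image, Set.Finite.mem_toFinset,
          Set.mem_ofPred_eq]
        constructor
        · rintro ⟨hv, hv'⟩
          rcases (hE c hc v hv).1 hv' with ⟨c', h, rfl⟩ | h
          · exact ⟨c', h, rfl⟩
          · exact absurd hhalt (by simpa using h.2.2)
        · rintro ⟨c', h, rfl⟩
          have := hlt c' (hG c c' hc h)
          exact ⟨this, (hE c hc _ this).2 (Or.inl ⟨c', h, rfl⟩)⟩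
      rw [this, Finset.sum_image fun a ha b hb => hinjOn (by simpa using ha) (by simpa using hb)]
      push_cast
      rfl

end

/-! ### Binary notation and encodings of matrices -/

theorem mem_binStr {i m : ℕ} : i ∈ binStr m ↔ m.testBit i = true := by
  simp only [binStr, Finset.mem_filter, Finset.mem_range, and_iff_right_iff_imp]
  intro h
  by_contra hle
  rw [Nat.testBit_eq_false_of_lt (Nat.size_le.1 (not_lt.1 hle))] at h
  exact Bool.false_ne_true h

theorem binStr_eq (m : ℕ) : binStr m = m.bitIndices.toFinset := by
  ext i; simp [mem_binStr]

theorem bin_binStr (m : ℕ) : bin (binStr m) = m := by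
  rw [bin, binStr_eq, Finset.sum_toFinset_bitIndices_two_pow]

theorem binStr_bin (X : Str) : binStr (bin X) = X := by
  rw [bin, binStr_eq, Finset.toFinset_bitIndices_sum_two_pow]

theorem lt_of_mem_binStr {i m b : ℕ} (h : i ∈ binStr m) (hm : m ≤ 2 ^ b) : i < b + 1 := by
  rw [mem_binStr] at h
  exact (Nat.pow_lt_pow_iff_right (by norm_num : 1 < 2)).1
    (((Nat.ge_two_pow_of_testBit h).trans hm).trans_lt (Nat.pow_lt_pow_succ (by norm_num)))

theorem pow_le_two_pow_mul (a k : ℕ) : a ^ k ≤ 2 ^ (a * k) := by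
  rw [pow_mul]
  exact Nat.pow_le_pow_left Nat.lt_two_pow_self.le k

theorem mem_encodeBinaryMatrix {n : ℕ} {A : Matrix (Fin n) (Fin n) ℕ} {b : ℕ} :
    b ∈ encodeBinaryMatrix A ↔
      ∃ i j : Fin n, ∃ l, l ∈ binStr (A i j) ∧ b = pair i (pair j l) := by
  simp [encodeBinaryMatrix, eq_comm]

theorem pair_mem_encodeBinaryMatrix {n : ℕ} {A : Matrix (Fin n) (Fin n) ℕ} (i j : Fin n)
    {l : ℕ} : pair i (pair j l) ∈ encodeBinaryMatrix A ↔ l ∈ binStr (A i j) := by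
  rw [mem_encodeBinaryMatrix]
  constructor
  · rintro ⟨i', j', l', h, he⟩
    simp only [pair_inj] at he
    obtain ⟨h₁, h₂, rfl⟩ := he
    obtain rfl := Fin.ext h₁
    obtain rfl := Fin.ext h₂
    exact h
  · exact fun h => ⟨i, j, l, h, rfl⟩

theorem mem_row {x i : ℕ} {Z : Str} : i ∈ row x Z ↔ pair x i ∈ Z := by
  simp only [row, Finset.mem_filter, Finset.mem_range, and_iff_right_iff_imp]
  exact fun h => (le_pair_right x i).trans_lt (lt_len h)

theorem seq_eq {x y : ℕ} {Z : Str} (h : pair x y ∈ Z) (hmin : ∀ z, pair x z ∈ Z → y ≤ z) :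
    seq x Z = y := by
  have hex : ∃ y, y < len Z ∧ pair x y ∈ Z := ⟨y, (le_pair_right x y).trans_lt (lt_len h), h⟩
  rw [seq, dif_pos hex]
  exact le_antisymm (Nat.find_le ⟨(le_pair_right x y).trans_lt (lt_len h), h⟩)
    (hmin _ (Nat.find_spec hex).2)

/-- The string encoding in unary the adjacency matrix of `E` on the numbers below `N`. -/
noncomputable def adjString (E : ℕ → ℕ → Prop) (N : ℕ) : Str :=
  open Classical in
  (Finset.range N ×ˢ Finset.range N).image fun u =>
    pair u.1 (pair u.2 (if E u.1 u.2 then 1 else 0))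

theorem mem_adjString {E : ℕ → ℕ → Prop} {N b : ℕ} :
    b ∈ adjString E N ↔ ∃ u, u ≤ b ∧ ∃ v, v ≤ b ∧ ∃ e, e ≤ 1 ∧
      (b = pair u (pair v e) ∧ u < N ∧ v < N ∧ (e = 1 ∧ E u v ∨ e = 0 ∧ ¬ E u v)) := by
  simp only [adjString, Finset.mem_image, Finset.mem_product, Finset.mem_range, Prod.exists]
  constructor
  · rintro ⟨u, v, ⟨hu, hv⟩, rfl⟩
    refine ⟨u, le_pair_left _ _, v, (le_pair_left _ _).trans (le_pair_right _ _), _, ?_, rfl, hu,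
      hv, ?_⟩
    · split_ifs <;> simp
    · split_ifs with h <;> simp [h]
  · rintro ⟨u, -, v, -, e, -, rfl, hu, hv, ⟨rfl, h⟩ | ⟨rfl, h⟩⟩ <;>
      exact ⟨u, v, ⟨hu, hv⟩, by simp [h]⟩

theorem lt_of_mem_adjString {E : ℕ → ℕ → Prop} {N b : ℕ} (h : b ∈ adjString E N) :
    b < pair N (pair N 1) + 1 := by
  obtain ⟨u, -, v, -, e, he, rfl, hu, hv, -⟩ := mem_adjString.1 h
  exact Nat.lt_succ_of_le (pair_le_pair hu.le (pair_le_pair hv.le he))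

theorem unaryMatrix_adjString (E : ℕ → ℕ → Prop) (N : ℕ) :
    unaryMatrix N (adjString E N) = adjMatrix E N := by
  classical
  have hmem : ∀ u v : Fin N, ∀ z, pair v z ∈ row u (adjString E N) ↔
      z = if E u v then 1 else 0 := by
    intro u v z
    rw [mem_row, adjString, Finset.mem_image]
    simp only [Prod.exists, Finset.mem_product, Finset.mem_range, pair_inj]
    constructor
    · rintro ⟨a, b, -, rfl, rfl, rfl⟩; rfl
    · rintro rfl; exact ⟨u, v, ⟨u.2, v.2⟩, rfl, rfl, rfl⟩
  ext u v
  simp only [unaryMatrix, adjMatrix, Matrix.of_apply, entry]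
  refine seq_eq ((hmem u v _).2 ?_) fun z hz => ?_
  · congr
  · rw [(hmem u v z).1 hz]

/-! ### Input words -/

/-- The symbols of the word `w`, which depends on number and string arguments, are given by
`Σ₀ᴮ`-formulas. The renaming `ρ` makes the notion available below quantifiers. -/
class WordDef (L : Collection) {n m : ℕ}
    (w : (Fin n → ℕ) → (Fin m → Str) → List InputSymbol) : Prop where
  length : TermDef L (fun x X => (w x X).length)
  get : ∀ {n' : ℕ} (ρ : Fin n → Fin n') (f : NumFun n' m), TermDef L f → ∀ s : InputSymbol,
    RelDef L (fun x X => (w (fun i => x (ρ i)) X)[f x X]? = some s)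

section
variable {L : Collection} {n m : ℕ} {w w₁ w₂ : (Fin n → ℕ) → (Fin m → Str) → List InputSymbol}

instance (priority := low) WordDef.rename {n' : ℕ} (ρ : Fin n → Fin n') [hw : WordDef L w] :
    WordDef L (fun x X => w (fun i => x (ρ i)) X) where
  length :=
    have := hw.length
    TermDef.rename ρ (f := fun x X => (w x X).length)
  get ρ' f hf s := hw.get (fun i => ρ' (ρ i)) f hf s

instance WordDef.termDef_length [hw : WordDef L w] : TermDef L (fun x X => (w x X).length) :=
  hw.length

theorem WordDef.nil : WordDef L (fun (_ : Fin n → ℕ) (_ : Fin m → Str) => []) where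
  length := by simp only [List.length_nil]; infer_instance
  get ρ f hf s := by simp only [List.getElem?_nil, reduceCtorEq]; infer_instance

theorem WordDef.append (h₁ : WordDef L w₁) (h₂ : WordDef L w₂) :
    WordDef L (fun x X => w₁ x X ++ w₂ x X) where
  length := by
    simp only [List.length_append]; infer_instance
  get ρ f hf s := by
    have := h₁.get ρ f hf s
    have := h₂.get (fun i => (ρ i).succ) (fun z X => z 0) inferInstance s
    refine RelDef.congr (R := fun x X =>
      (f x X < (w₁ (fun i => x (ρ i)) X).length ∧ (w₁ (fun i => x (ρ i)) X)[f x X]? = some s) ∨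
      ∃ y, y ≤ f x X ∧ (f x X = (w₁ (fun i => x (ρ i)) X).length + y ∧
        (w₂ (fun i => x (ρ i)) X)[y]? = some s)) (fun x X => ?_) inferInstance
    by_cases h : f x X < (w₁ (fun i => x (ρ i)) X).length
    · rw [List.getElem?_append_left h]
      constructor
      · rintro (h' | ⟨y, -, h', -⟩)
        · exact h'.2
        · omega
      · exact fun h' => Or.inl ⟨h, h'⟩
    · rw [List.getElem?_append_right (not_lt.1 h)]
      constructor
      · rintro (h' | ⟨y, -, h', h''⟩)
        · exact absurd h'.1 h
        · rwa [h', Nat.add_sub_cancel_left]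
      · exact fun h' => Or.inr ⟨_, Nat.sub_le _ _, by omega, h'⟩

theorem WordDef.flatten {k : ℕ} {w : Fin k → (Fin n → ℕ) → (Fin m → Str) → List InputSymbol}
    (h : ∀ i, WordDef L (w i)) : WordDef L (fun x X => (List.ofFn fun i => w i x X).flatten) := by
  induction k with
  | zero => simpa using WordDef.nil
  | succ k ih =>
    simp only [List.ofFn_succ, List.flatten_cons]
    exact (h 0).append (ih fun i => h i.succ)

theorem getElem?_encodeNum (x i : ℕ) (s : InputSymbol) :
    (encodeNum x)[i]? = some s ↔ (i < x ∧ s = .bit true) ∨ (i = x ∧ s = .sep) := by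
  unfold encodeNum
  rcases lt_trichotomy i x with h | h | h
  · rw [List.getElem?_append_left (by simpa using h), List.getElem?_replicate, if_pos h]
    simp [h, h.ne, eq_comm]
  · subst h; simp [eq_comm]
  · simp only [h.not_gt, h.ne', false_and, or_self, iff_false]
    rw [List.getElem?_eq_none (by simpa using h)]
    simp

theorem getElem?_encodeStr (X : Str) (i : ℕ) (s : InputSymbol) :
    (encodeStr X)[i]? = some s ↔
      (i < len X ∧ (i ∈ X ∧ s = .bit true ∨ i ∉ X ∧ s = .bit false)) ∨ (i = len X ∧ s = .sep) := by
  unfold encodeStr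
  rcases lt_trichotomy i (len X) with h | h | h
  · rw [List.getElem?_append_left (by simpa using h)]
    by_cases hi : i ∈ X <;> simp [h, h.ne, hi, eq_comm]
  · subst h; simp [eq_comm]
  · simp only [h.not_gt, h.ne', false_and, or_self, iff_false]
    rw [List.getElem?_eq_none (by simpa using h)]
    simp

theorem WordDef.encodeNum {f : NumFun n m} [hf : TermDef L f] :
    WordDef L (fun x X => encodeNum (f x X)) where
  length := by
    simp only [TwoSorted.encodeNum, List.length_append, List.length_replicate, List.length_cons,
      List.length_nil]
    infer_instance
  get ρ g hg s := by
    simp only [getElem?_encodeNum]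
    infer_instance

theorem WordDef.encodeStr {F : StrFun n m} [hf : StrTermDef L F] :
    WordDef L (fun x X => encodeStr (F x X)) where
  length := by
    simp only [TwoSorted.encodeStr, List.length_append, List.length_map, List.length_range,
      List.length_cons, List.length_nil]
    infer_instance
  get ρ g hg s := by
    simp only [getElem?_encodeStr]
    infer_instance

instance WordDef.encodeInput : WordDef L (encodeInput (a := n) (b := m)) :=
  (WordDef.flatten fun i => WordDef.encodeNum (f := fun x _ => x i)).append
    (WordDef.flatten fun i => WordDef.encodeStr (F := fun _ X => X i))

instance WordDef.readInput [hw : WordDef L w] {f : NumFun n m} [hf : TermDef L f]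
    {s : InputSymbol} : RelDef L (fun x X => Machine.readInput (w x X) (f x X) = s) := by
  have := hw.get Fin.succ (fun z X => z 0) inferInstance s
  refine RelDef.congr (R := fun x X => (f x X = 0 ∧ InputSymbol.leftEnd = s) ∨
    ∃ j, j ≤ f x X ∧ (f x X = j + 1 ∧ ((w x X)[j]? = some s ∨
      (w x X).length ≤ j ∧ InputSymbol.rightEnd = s))) (fun x X => ?_) inferInstance
  rcases f x X with _ | i
  · simp [Machine.readInput]
  · simp only [Machine.readInput, List.getD_eq_getElem?_getD, Nat.add_eq_zero_iff, one_ne_zero,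
      and_false, false_and, false_or, Nat.add_right_cancel_iff]
    constructor
    · rintro ⟨j, -, rfl, h | ⟨h, rfl⟩⟩
      · simp [h]
      · simp [List.getElem?_eq_none_iff.2 h]
    · intro h
      refine ⟨i, Nat.le_succ i, rfl, ?_⟩
      cases hi : (w x X)[i]? with
      | none => exact Or.inr ⟨List.getElem?_eq_none_iff.1 hi, by simpa [hi] using h⟩
      | some t => exact Or.inl (by simpa [hi] using h)

end

theorem length_encodeInput {a b : ℕ} (x : Fin a → ℕ) (X : Fin b → Str) :
    (encodeInput x X).length = ∑ i, (x i + 1) + ∑ i, (len (X i) + 1) := by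
  simp [encodeInput, List.length_flatten, List.sum_ofFn, Function.comp_def, encodeNum, encodeStr]

instance : Finite Move :=
  Finite.of_injective (β := Fin 3) (fun | .left => 0 | .stay => 1 | .right => 2)
    (by rintro ⟨⟩ ⟨⟩ <;> simp)

instance : Finite InputSymbol :=
  Finite.of_injective (β := Fin 5)
    (fun | .bit true => 0 | .bit false => 1 | .sep => 2 | .leftEnd => 3 | .rightEnd => 4)
    (by rintro (⟨⟨⟩⟩ | _ | _ | _) (⟨⟨⟩⟩ | _ | _ | _) <;> simp)

/-! ### Stacks as numbers -/

/-- The number whose base-`B` digits, least significant first, are `f 0, …, f (K - 1)`. -/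
def stack (B : ℕ) (f : ℕ → ℕ) (K : ℕ) : ℕ := ∑ j ∈ Finset.range K, f j * B ^ j

section
variable {B : ℕ}

theorem stack_succ (f : ℕ → ℕ) (K : ℕ) :
    stack B f (K + 1) = f 0 + B * stack B (fun j => f (j + 1)) K := by
  rw [stack, Finset.sum_range_succ', stack, Finset.mul_sum, add_comm]
  congr 1
  · simp
  · exact Finset.sum_congr rfl fun j _ => by ring

theorem stack_eq_of_top_zero {f : ℕ → ℕ} {K : ℕ} (h : f K = 0) :
    stack B f (K + 1) = stack B f K := by
  rw [stack, Finset.sum_range_succ, h, zero_mul, add_zero, stack]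

theorem stack_lt {f : ℕ → ℕ} (hf : ∀ j, f j < B) (K : ℕ) : stack B f K < B ^ K := by
  induction K generalizing f with
  | zero => simp [stack]
  | succ K ih =>
    rw [stack_succ, pow_succ']
    have := ih fun j => hf (j + 1)
    have := Nat.mul_le_mul_left B (Nat.succ_le_of_lt this)
    have := hf 0
    rw [Nat.mul_succ] at *
    omega

theorem add_mul_inj {a a' b b' : ℕ} (ha : a < B) (ha' : a' < B) :
    a + B * b = a' + B * b' ↔ a = a' ∧ b = b' := by
  refine ⟨fun h => ?_, fun h => by rw [h.1, h.2]⟩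
  have h₁ := congrArg (· % B) h
  simp only [Nat.add_mul_mod_self_left, Nat.mod_eq_of_lt ha, Nat.mod_eq_of_lt ha'] at h₁
  subst h₁
  exact ⟨rfl, Nat.eq_of_mul_eq_mul_left (Nat.zero_lt_of_lt ha) (Nat.add_left_cancel h)⟩

theorem eq_of_stack_eq {f g : ℕ → ℕ} (hf : ∀ j, f j < B) (hg : ∀ j, g j < B) {K : ℕ}
    (h : stack B f K = stack B g K) : ∀ j < K, f j = g j := by
  induction K generalizing f g with
  | zero => exact fun j hj => absurd hj (Nat.not_lt_zero j)
  | succ K ih =>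
    rw [stack_succ, stack_succ, add_mul_inj (hf 0) (hg 0)] at h
    rintro (_ | j) hj
    · exact h.1
    · exact ih (fun j => hf (j + 1)) (fun j => hg (j + 1)) h.2 j (Nat.succ_lt_succ_iff.1 hj)

end

/-! ### Configurations as numbers -/

namespace Machine

/-- Numberings of the states and of the work tape symbols of a machine; the blank has number `0`. -/
structure Coding (M : Machine) where
  st : M.State → ℕ
  st_inj : Function.Injective st
  Q : ℕ
  st_lt : ∀ q, st q < Q
  sym : M.Symbol → ℕ
  sym_inj : Function.Injective sym
  sym_blank : sym M.blank = 0
  B : ℕ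
  sym_lt : ∀ a, sym a < B

theorem nonempty_coding (M : Machine) : Nonempty M.Coding := by
  classical
  have := M.finState
  have := M.finSymbol
  let e := Finite.equivFin M.State
  let e' := Finite.equivFin M.Symbol
  exact ⟨{
    st := fun q => e q
    st_inj := fun a b h => e.injective (Fin.ext h)
    Q := Nat.card M.State
    st_lt := fun q => (e q).2
    sym := fun a => if a = M.blank then 0 else e' a + 1
    sym_inj := fun a b h => by
      dsimp only at h
      split_ifs at h with ha hb hb
      · rw [ha, hb]
      · exact e'.injective (Fin.ext (Nat.succ_injective h))
    sym_blank := if_pos rfl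
    B := Nat.card M.Symbol + 1
    sym_lt := fun a => by
      split_ifs
      · exact Nat.succ_pos _
      · exact Nat.succ_lt_succ (e' a).2 }⟩

variable {M : Machine}

/-- The number of a configuration with state number `q`, input position `i`, work position `p`
(shifted to be nonnegative), scanned symbol `h` and stacks `l`, `r` of the symbols to the left and
to the right of the work head. It is not `0`. -/
def encConfig (q i p l h r : ℕ) : ℕ := pair (q + 1) (pair i (pair p (pair l (pair h r))))

theorem encConfig_inj {q i p l h r q' i' p' l' h' r' : ℕ} :
    encConfig q i p l h r = encConfig q' i' p' l' h' r' ↔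
      q = q' ∧ i = i' ∧ p = p' ∧ l = l' ∧ h = h' ∧ r = r' := by
  simp [encConfig, pair_inj]

theorem encConfig_pos (q i p l h r : ℕ) : 0 < encConfig q i p l h r :=
  (Nat.succ_pos q).trans_le (le_pair_left _ _)

theorem le_encConfig (q i p l h r : ℕ) :
    i ≤ encConfig q i p l h r ∧ p ≤ encConfig q i p l h r ∧ l ≤ encConfig q i p l h r ∧
      h ≤ encConfig q i p l h r ∧ r ≤ encConfig q i p l h r := by
  have h₁ := le_pair_right (q + 1) (pair i (pair p (pair l (pair h r))))
  have h₂ := le_pair_right i (pair p (pair l (pair h r)))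
  have h₃ := le_pair_right p (pair l (pair h r))
  have h₄ := le_pair_right l (pair h r)
  have h₂' := le_pair_left i (pair p (pair l (pair h r)))
  have h₃' := le_pair_left p (pair l (pair h r))
  have h₄' := le_pair_left l (pair h r)
  have h₅ := le_pair_left h r
  have h₅' := le_pair_right h r
  unfold encConfig
  omega

/-- The effect of a head movement on a nonnegative position. -/
def moveRel : Move → ℕ → ℕ → Prop
  | .left, p, p' => p = p' + 1
  | .stay, p, p' => p' = p
  | .right, p, p' => p' = p + 1

theorem moveRel_iff {d : Move} {p p' : ℕ} : moveRel d p p' ↔ (p' : ℤ) = p + d.toInt := by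
  cases d <;> simp only [moveRel, Move.toInt] <;> omega

/-- The effect of writing `g` and then moving the work head on the stacks `l`, `r` of base-`B`
digits to the left and right of the head; `l'`, `h'`, `r'` are the new left stack, the newly scanned
digit and the new right stack. -/
def tapeRel (B g : ℕ) : Move → ℕ → ℕ → ℕ → ℕ → ℕ → Prop
  | .left, l, r, l', h', r' => r' = g + B * r ∧ l = h' + B * l' ∧ h' < B
  | .stay, l, r, l', h', r' => l' = l ∧ h' = g ∧ r' = r
  | .right, l, r, l', h', r' => l' = g + B * l ∧ r = h' + B * r' ∧ h' < B

/-- The transitions of a machine. -/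
abbrev Transition (M : Machine) : Type :=
  {τ : (M.State × InputSymbol × M.Symbol) × (M.State × M.Symbol × Move × Move) //
    M.trans τ.1.1 τ.1.2.1 τ.1.2.2 τ.2.1 τ.2.2.1 τ.2.2.2.1 τ.2.2.2.2}

instance : Finite M.Transition :=
  have := M.finState
  have := M.finSymbol
  inferInstance

/-- The numbers `u` and `v` code configurations that are related by a step on the word `w`. -/
def stepCode (C : M.Coding) (w : List InputSymbol) (u v : ℕ) : Prop :=
  ∃ τ : M.Transition, ∃ i, i ≤ u ∧ ∃ p, p ≤ u ∧ ∃ l, l ≤ u ∧ ∃ r, r ≤ u ∧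
    (u = encConfig (C.st τ.1.1.1) i p l (C.sym τ.1.1.2.2) r ∧ readInput w i = τ.1.1.2.1 ∧
      ∃ i', i' ≤ v ∧ ∃ p', p' ≤ v ∧ ∃ l', l' ≤ v ∧ ∃ h', h' ≤ v ∧ ∃ r', r' ≤ v ∧
        (v = encConfig (C.st τ.1.2.1) i' p' l' h' r' ∧ i' ≤ w.length + 1 ∧
          moveRel τ.1.2.2.2.1 i i' ∧ moveRel τ.1.2.2.2.2 p p' ∧
          tapeRel C.B (C.sym τ.1.2.2.1) τ.1.2.2.2.2 l r l' h' r'))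

/-- The number `u` codes an accepting configuration without successors below `N`. -/
def haltCode (C : M.Coding) (w : List InputSymbol) (N u : ℕ) : Prop :=
  (∃ q : M.State, ∃ i, i ≤ u ∧ ∃ p, p ≤ u ∧ ∃ l, l ≤ u ∧ ∃ h, h ≤ u ∧ ∃ r, r ≤ u ∧
    (u = encConfig (C.st q) i p l h r ∧ q ∈ M.accept)) ∧ ¬ ∃ v, v < N ∧ stepCode C w u v

/-- The configuration graph on codes, with edges from the accepting halting configurations to the
sink `0` and a loop at the sink. -/
def configGraph (C : M.Coding) (w : List InputSymbol) (N u v : ℕ) : Prop :=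
  stepCode C w u v ∨ (v = 0 ∧ haltCode C w N u) ∨ (u = 0 ∧ v = 0)

/-! ### Definability of the configuration graph -/

section
variable {L : Collection} {n m : ℕ} {f g : NumFun n m}

instance [TermDef L f] [TermDef L g] {d : Move} :
    RelDef L (fun x X => moveRel d (f x X) (g x X)) := by
  cases d <;> unfold moveRel <;> infer_instance

instance {B a : ℕ} {d : Move} {l r l' h' r' : NumFun n m} [TermDef L l] [TermDef L r]
    [TermDef L l'] [TermDef L h'] [TermDef L r'] :
    RelDef L (fun x X => tapeRel B a d (l x X) (r x X) (l' x X) (h' x X) (r' x X)) := by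
  cases d <;> unfold tapeRel <;> infer_instance

instance {q i p l h r : NumFun n m} [TermDef L q] [TermDef L i] [TermDef L p] [TermDef L l]
    [TermDef L h] [TermDef L r] :
    TermDef L (fun x X => encConfig (q x X) (i x X) (p x X) (l x X) (h x X) (r x X)) := by
  unfold encConfig; infer_instance

variable {w : (Fin n → ℕ) → (Fin m → Str) → List InputSymbol}

instance {C : M.Coding} [WordDef L w] [TermDef L f] [TermDef L g] :
    RelDef L (fun x X => stepCode C (w x X) (f x X) (g x X)) := by
  unfold stepCode
  infer_instance

instance {C : M.Coding} {N : NumFun n m} [WordDef L w] [TermDef L f] [TermDef L N] :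
    RelDef L (fun x X => haltCode C (w x X) (N x X) (f x X)) := by
  have := M.finState
  unfold haltCode
  infer_instance

instance {C : M.Coding} {N : NumFun n m} [WordDef L w] [TermDef L f] [TermDef L g]
    [TermDef L N] : RelDef L (fun x X => configGraph C (w x X) (N x X) (f x X) (g x X)) := by
  unfold configGraph
  infer_instance

end

/-! ### Configurations and their codes -/

/-- The symbols to the left of the work head, the nearest first. -/
def Config.leftDigits (C : M.Coding) (c : M.Config) (j : ℕ) : ℕ :=
  C.sym (c.work (c.workPos - 1 - j))

/-- The symbols to the right of the work head, the nearest first. -/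
def Config.rightDigits (C : M.Coding) (c : M.Config) (j : ℕ) : ℕ :=
  C.sym (c.work (c.workPos + 1 + j))

/-- The code of a configuration, for stacks of height `K` and work positions shifted by `s₀`. -/
def Config.code (C : M.Coding) (s₀ K : ℕ) (c : M.Config) : ℕ :=
  encConfig (C.st c.state) c.inputPos (c.workPos + s₀).toNat (stack C.B (c.leftDigits C) K)
    (C.sym (c.work c.workPos)) (stack C.B (c.rightDigits C) K)

/-- The input head is on the tape and the work head in the window `[-s, s]`, outside of which the
work tape is blank. -/
structure Config.Tidy (c : M.Config) (ℓ s : ℕ) : Prop where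
  input : c.inputPos ≤ ℓ + 1
  pos : c.workPos.natAbs ≤ s
  blank : ∀ z : ℤ, s < z.natAbs → c.work z = M.blank

theorem Config.Tidy.step {w : List InputSymbol} {s : ℕ} {c c' : M.Config}
    (hc : c.Tidy w.length s) (h : M.Step w c c') (hs : c'.workPos.natAbs ≤ s) :
    c'.Tidy w.length s := by
  obtain ⟨g, d, d', -, -, hi, hw, -⟩ := h
  refine ⟨hi, hs, fun z hz => ?_⟩
  rw [hw, Function.update_of_ne, hc.blank z hz]
  rintro rfl
  exact absurd hc.pos (not_le.2 hz)

section
variable {C : M.Coding} {c c' : M.Config} {ℓ s s₀ K : ℕ}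

theorem Config.Tidy.leftDigits_eq_zero (hc : c.Tidy ℓ s) {j : ℕ} (hj : 2 * s ≤ j) :
    c.leftDigits C j = 0 := by
  rw [Config.leftDigits, hc.blank, C.sym_blank]
  have := hc.pos
  omega

theorem Config.Tidy.rightDigits_eq_zero (hc : c.Tidy ℓ s) {j : ℕ} (hj : 2 * s ≤ j) :
    c.rightDigits C j = 0 := by
  rw [Config.rightDigits, hc.blank, C.sym_blank]
  have := hc.pos
  omega

theorem Config.Tidy.code_inj (hc : c.Tidy ℓ s) (hc' : c'.Tidy ℓ s) (hs : s ≤ s₀)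
    (h : c.code C s₀ (2 * s) = c'.code C s₀ (2 * s)) : c = c' := by
  obtain ⟨hq, hi, hp, hl, hh, hr⟩ := encConfig_inj.1 h
  have hl := eq_of_stack_eq (fun j => C.sym_lt _) (fun j => C.sym_lt _) hl
  have hr := eq_of_stack_eq (fun j => C.sym_lt _) (fun j => C.sym_lt _) hr
  have hpos : c.workPos = c'.workPos := by
    have := hc.pos
    have := hc'.pos
    omega
  have hwork : c.work = c'.work := by
    funext z
    by_cases hz : s < z.natAbs
    · rw [hc.blank z hz, hc'.blank z hz]
    have := hc.pos
    rcases lt_trichotomy z c.workPos with hlt | heq | hlt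
    · have := hl (c.workPos - 1 - z).toNat (by omega)
      rw [← hpos, show c.workPos - 1 - ((c.workPos - 1 - z).toNat : ℤ) = z by omega] at this
      exact C.sym_inj this
    · rw [← hpos, ← heq] at hh
      exact C.sym_inj hh
    · have := hr (z - c.workPos - 1).toNat (by omega)
      rw [← hpos, show c.workPos + 1 + ((z - c.workPos - 1).toNat : ℤ) = z by omega] at this
      exact C.sym_inj this
  have hst := C.st_inj hq
  cases c; cases c'
  simp_all

/-- Pushing and popping: the stacks after a step satisfy linear equations over the old ones. -/
theorem tapeRel_iff {g : M.Symbol} {d : Move} (hc : c.Tidy ℓ s) (hc' : c'.Tidy ℓ s)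
    (hw : c'.work = Function.update c.work c.workPos g) (hp : c'.workPos = c.workPos + d.toInt)
    {l h r : ℕ} :
    tapeRel C.B (C.sym g) d (stack C.B (c.leftDigits C) (2 * s))
      (stack C.B (c.rightDigits C) (2 * s)) l h r ↔
    l = stack C.B (c'.leftDigits C) (2 * s) ∧ h = C.sym (c'.work c'.workPos) ∧
      r = stack C.B (c'.rightDigits C) (2 * s) := by
  -- the digits at height `2 * s` are blank, so the stacks may be given height `2 * s + 1`
  have hl := stack_succ (B := C.B) (c.leftDigits C) (2 * s)
  have hr := stack_succ (B := C.B) (c.rightDigits C) (2 * s)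
  have hl' := stack_succ (B := C.B) (c'.leftDigits C) (2 * s)
  have hr' := stack_succ (B := C.B) (c'.rightDigits C) (2 * s)
  rw [stack_eq_of_top_zero (hc.leftDigits_eq_zero le_rfl)] at hl
  rw [stack_eq_of_top_zero (hc.rightDigits_eq_zero le_rfl)] at hr
  rw [stack_eq_of_top_zero (hc'.leftDigits_eq_zero le_rfl)] at hl'
  rw [stack_eq_of_top_zero (hc'.rightDigits_eq_zero le_rfl)] at hr'
  have hne : ∀ z, z ≠ c.workPos → c'.work z = c.work z := fun z hz => by
    rw [hw, Function.update_of_ne hz]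
  have heq : c'.work c.workPos = g := by rw [hw, Function.update_self]
  cases d with
  | stay =>
    simp only [Move.toInt, add_zero] at hp
    have h₁ : c'.leftDigits C = c.leftDigits C := funext fun j => by
      rw [Config.leftDigits, Config.leftDigits, hp, hne _ (by omega)]
    have h₂ : c'.rightDigits C = c.rightDigits C := funext fun j => by
      rw [Config.rightDigits, Config.rightDigits, hp, hne _ (by omega)]
    rw [tapeRel, h₁, h₂, hp, heq]
  | right =>
    simp only [Move.toInt] at hp
    have h₁ : (fun j => c'.leftDigits C (j + 1)) = c.leftDigits C := funext fun j => by
      rw [Config.leftDigits, Config.leftDigits, hp, hne _ (by push_cast; omega)]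
      congr 2; push_cast; ring
    have h₂ : (fun j => c.rightDigits C (j + 1)) = c'.rightDigits C := funext fun j => by
      rw [Config.rightDigits, Config.rightDigits, hp, hne _ (by omega)]
      congr 2; push_cast; ring
    have h₃ : c'.leftDigits C 0 = C.sym g := by
      rw [Config.leftDigits, hp, ← heq]; congr 2; push_cast; ring
    have h₄ : c.rightDigits C 0 = C.sym (c'.work c'.workPos) := by
      rw [Config.rightDigits, hp, hne _ (by omega)]; congr 2; push_cast; ring
    rw [h₁, h₃] at hl'
    rw [h₂, h₄] at hr
    rw [tapeRel, hl', hr]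
    constructor
    · rintro ⟨rfl, h₅, h₆⟩
      obtain ⟨h₇, h₈⟩ := (add_mul_inj (C.sym_lt _) h₆).1 h₅
      exact ⟨rfl, h₇.symm, h₈.symm⟩
    · rintro ⟨rfl, rfl, rfl⟩
      exact ⟨rfl, rfl, C.sym_lt _⟩
  | left =>
    simp only [Move.toInt] at hp
    have h₁ : (fun j => c'.rightDigits C (j + 1)) = c.rightDigits C := funext fun j => by
      rw [Config.rightDigits, Config.rightDigits, hp, hne _ (by push_cast; omega)]
      congr 2; push_cast; ring
    have h₂ : (fun j => c.leftDigits C (j + 1)) = c'.leftDigits C := funext fun j => by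
      rw [Config.leftDigits, Config.leftDigits, hp, hne _ (by omega)]
      congr 2; push_cast; ring
    have h₃ : c'.rightDigits C 0 = C.sym g := by
      rw [Config.rightDigits, hp, ← heq]; congr 2; push_cast; ring
    have h₄ : c.leftDigits C 0 = C.sym (c'.work c'.workPos) := by
      rw [Config.leftDigits, hp, hne _ (by omega)]; congr 2; push_cast; ring
    rw [h₁, h₃] at hr'
    rw [h₂, h₄] at hl
    rw [tapeRel, hr', hl]
    constructor
    · rintro ⟨rfl, h₅, h₆⟩
      obtain ⟨h₇, h₈⟩ := (add_mul_inj (C.sym_lt _) h₆).1 h₅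
      exact ⟨h₈.symm, h₇.symm, rfl⟩
    · rintro ⟨rfl, rfl, rfl⟩
      exact ⟨rfl, rfl, C.sym_lt _⟩

/-- On tidy configurations whose successors are tidy, `stepCode` is the step relation. -/
theorem stepCode_code_iff {w : List InputSymbol} (hs : s ≤ s₀) (hc : c.Tidy w.length s)
    (hsucc : ∀ c', M.Step w c c' → c'.Tidy w.length s) {v : ℕ} :
    stepCode C w (c.code C s₀ (2 * s)) v ↔ ∃ c', M.Step w c c' ∧ v = c'.code C s₀ (2 * s) := by
  have hpos := hc.pos
  constructor
  · rintro ⟨⟨⟨⟨q, a, b⟩, q', g, d, d'⟩, hτ⟩, i, -, p, -, l, -, r, -, hu, hin, i', -, p', -, l', -,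
      h', -, r', -, rfl, hi', hd, hd', htape⟩
    simp only at hu hin hτ hd hd' htape ⊢
    obtain ⟨hq, rfl, rfl, rfl, hb, rfl⟩ := encConfig_inj.1 hu
    obtain rfl := C.st_inj hq
    obtain rfl := C.sym_inj hb
    subst hin
    let c' : M.Config := ⟨q', i', Function.update c.work c.workPos g, c.workPos + d'.toInt⟩
    have hstep : M.Step w c c' := ⟨g, d, d', hτ, moveRel_iff.1 hd, hi', rfl, rfl⟩
    refine ⟨c', hstep, ?_⟩
    obtain ⟨rfl, rfl, rfl⟩ := (tapeRel_iff hc (hsucc c' hstep) rfl rfl).1 htape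
    rw [Config.code, encConfig_inj]
    refine ⟨rfl, rfl, ?_, rfl, rfl, rfl⟩
    have h₁ := moveRel_iff.1 hd'
    have h₂ : c'.workPos = c.workPos + d'.toInt := rfl
    omega
  · rintro ⟨c', hstep, rfl⟩
    have hc' := hsucc c' hstep
    obtain ⟨g, d, d', hτ, hi, hi', hw, hp⟩ := hstep
    have h₁ := le_encConfig (C.st c.state) c.inputPos (c.workPos + s₀).toNat
      (stack C.B (c.leftDigits C) (2 * s)) (C.sym (c.work c.workPos))
      (stack C.B (c.rightDigits C) (2 * s))
    have h₂ := le_encConfig (C.st c'.state) c'.inputPos (c'.workPos + s₀).toNat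
      (stack C.B (c'.leftDigits C) (2 * s)) (C.sym (c'.work c'.workPos))
      (stack C.B (c'.rightDigits C) (2 * s))
    refine ⟨⟨⟨⟨c.state, readInput w c.inputPos, c.work c.workPos⟩, c'.state, g, d, d'⟩, hτ⟩, _,
      h₁.1, _, h₁.2.1, _, h₁.2.2.1, _, h₁.2.2.2.2, rfl, rfl, _, h₂.1, _, h₂.2.1, _, h₂.2.2.1, _,
      h₂.2.2.2.1, _, h₂.2.2.2.2, rfl, hi', moveRel_iff.2 hi, moveRel_iff.2 ?_,
      (tapeRel_iff hc hc' hw hp).2 ⟨rfl, rfl, rfl⟩⟩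
    have := hc'.pos
    dsimp only
    omega

end

/-- The configurations reachable from the initial one. -/
def Reachable (M : Machine) (w : List InputSymbol) (c : M.Config) : Prop :=
  Relation.ReflTransGen (M.Step w) M.init c

theorem Reachable.tidy {w : List InputSymbol} {s t : ℕ}
    (hM : PathsWithin (M.Step w) (fun c => c.workPos.natAbs ≤ s) M.init t) {c : M.Config}
    (hc : M.Reachable w c) : c.Tidy w.length s := by
  have hwin : ∀ {c}, M.Reachable w c → c.workPos.natAbs ≤ s := by
    intro c hc
    obtain ⟨p, hp, hlast⟩ := List.exists_isChain_cons_of_relationReflTransGen hc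
    exact (hM _ rfl hp).2 c (hlast ▸ List.getLast_mem _)
  induction hc with
  | refl => exact ⟨Nat.zero_le _, by simp [init], fun _ _ => rfl⟩
  | tail h₁ h₂ ih => exact ih.step h₂ (hwin (h₁.tail h₂))

theorem acceptingPaths_eq (w : List InputSymbol) :
    M.acceptingPaths w = accPaths (M.Step w) {c | c.state ∈ M.accept} M.init := rfl

/-- A bound for the codes of tidy configurations on a word of length `ℓ`; it is a polynomial in `ℓ`,
as `c` and the numbers of states and symbols are constants. -/
def codeBound (C : M.Coding) (c ℓ : ℕ) : ℕ :=
  encConfig C.Q (ℓ + 1) (2 * (c * (ℓ + 1))) ((2 * (ℓ + 1)) ^ (2 * c * C.B)) C.B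
    ((2 * (ℓ + 1)) ^ (2 * c * C.B)) + 1

/-- Stacks of logarithmic height are polynomially bounded numbers. -/
theorem pow_log_le (B c ℓ : ℕ) :
    B ^ (2 * (c * (Nat.log 2 ℓ + 1))) ≤ (2 * (ℓ + 1)) ^ (2 * c * B) := by
  have h : 2 ^ (Nat.log 2 ℓ + 1) ≤ 2 * (ℓ + 1) := by
    rw [pow_succ, mul_comm]
    rcases Nat.eq_zero_or_pos ℓ with rfl | hℓ
    · simp
    · exact Nat.mul_le_mul_left 2 ((Nat.pow_log_le_self 2 hℓ.ne').trans (Nat.le_succ ℓ))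
  calc B ^ (2 * (c * (Nat.log 2 ℓ + 1)))
      ≤ 2 ^ (B * (2 * (c * (Nat.log 2 ℓ + 1)))) := pow_le_two_pow_mul _ _
    _ = (2 ^ (Nat.log 2 ℓ + 1)) ^ (2 * c * B) := by rw [← pow_mul]; congr 1; ring
    _ ≤ _ := Nat.pow_le_pow_left h _

theorem window_le (c ℓ : ℕ) : c * (Nat.log 2 ℓ + 1) ≤ c * (ℓ + 1) :=
  Nat.mul_le_mul_left c (Nat.succ_le_succ (Nat.log_le_self 2 ℓ))

theorem Config.Tidy.code_lt (C : M.Coding) {c ℓ : ℕ} {k : M.Config}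
    (hk : k.Tidy ℓ (c * (Nat.log 2 ℓ + 1))) :
    k.code C (c * (ℓ + 1)) (2 * (c * (Nat.log 2 ℓ + 1))) < codeBound C c ℓ := by
  have hpos := hk.pos
  have hw := window_le c ℓ
  have hP := pow_log_le C.B c ℓ
  refine Nat.lt_succ_of_le (pair_le_pair (Nat.succ_le_succ (C.st_lt _).le) (pair_le_pair hk.input
    (pair_le_pair (by omega) (pair_le_pair ?_ (pair_le_pair (C.sym_lt _).le ?_)))))
  · exact (stack_lt (fun j => C.sym_lt _) _).le.trans hP
  · exact (stack_lt (fun j => C.sym_lt _) _).le.trans hP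

/-- The number of accepting computation paths is a number of walks in the configuration graph. -/
theorem encard_acceptingPaths (C : M.Coding) {w : List InputSymbol} {c t : ℕ}
    (hM : PathsWithin (M.Step w)
      (fun k => k.workPos.natAbs ≤ c * (Nat.log 2 w.length + 1)) M.init t) :
    (M.acceptingPaths w).encard =
      walkCount (configGraph C w (codeBound C c w.length)) (codeBound C c w.length) t
        (encConfig (C.st M.start) 0 (c * (w.length + 1)) 0 0 0) := by
  set s := c * (Nat.log 2 w.length + 1) with hs
  set s₀ := c * (w.length + 1) with hs₀
  set N := codeBound C c w.length
  have hss₀ : s ≤ s₀ := window_le c w.length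
  have hinit : encConfig (C.st M.start) 0 s₀ 0 0 0 = M.init.code C s₀ (2 * s) := by
    simp [Config.code, init, stack, Config.leftDigits, Config.rightDigits, C.sym_blank]
  have htidy : ∀ k, M.Reachable w k → k.Tidy w.length s := fun k hk => hk.tidy hM
  have hstep : ∀ k k', M.Reachable w k → M.Step w k k' → M.Reachable w k' :=
    fun k k' hk h => hk.tail h
  have hcode : ∀ k, M.Reachable w k → ∀ v, stepCode C w (k.code C s₀ (2 * s)) v ↔
      ∃ k', M.Step w k k' ∧ v = k'.code C s₀ (2 * s) := fun k hk v =>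
    stepCode_code_iff hss₀ (htidy k hk) fun k' h => htidy k' (hstep k k' hk h)
  rw [acceptingPaths_eq, hinit]
  refine encard_accPaths_eq_walkCount (G := M.Reachable w) (Nat.succ_pos _) hstep
    (fun k hk => (htidy k hk).code_lt C) (fun k k' hk hk' h =>
      (htidy k hk).code_inj (htidy k' hk') hss₀ h) (fun k hk v _ => ?_) (fun v _ => ?_)
    Relation.ReflTransGen.refl hM
  · have hpos : k.code C s₀ (2 * s) ≠ 0 := (encConfig_pos _ _ _ _ _ _).ne'
    have hhalt : haltCode C w N (k.code C s₀ (2 * s)) ↔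
        k ∈ {c : M.Config | c.state ∈ M.accept} ∧ ∀ k', ¬ M.Step w k k' := by
      refine and_congr ?_ ?_
      · constructor
        · rintro ⟨q, i, -, p, -, l, -, h, -, r, -, hu, hq⟩
          obtain rfl := C.st_inj (encConfig_inj.1 hu).1
          exact hq
        · intro hq
          have := le_encConfig (C.st k.state) k.inputPos (k.workPos + s₀).toNat
            (stack C.B (k.leftDigits C) (2 * s)) (C.sym (k.work k.workPos))
            (stack C.B (k.rightDigits C) (2 * s))
          exact ⟨k.state, _, this.1, _, this.2.1, _, this.2.2.1, _, this.2.2.2.1, _,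
            this.2.2.2.2, rfl, hq⟩
      · constructor
        · exact fun h k' hk' => h ⟨_, (htidy k' (hstep k k' hk hk')).code_lt C,
            (hcode k hk _).2 ⟨k', hk', rfl⟩⟩
        · rintro h ⟨v, -, hv⟩
          obtain ⟨k', hk', -⟩ := (hcode k hk v).1 hv
          exact h k' hk'
    rw [configGraph, hcode k hk, hhalt]
    constructor
    · rintro (h | h | h)
      exacts [Or.inl h, Or.inr h, absurd h.1 hpos]
    · rintro (h | h)
      exacts [Or.inl h, Or.inr (Or.inl h)]
  · have h₁ : ¬ stepCode C w 0 v := by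
      rintro ⟨τ, i, -, p, -, l, -, r, -, hu, -⟩
      exact (encConfig_pos _ _ _ _ _ _).ne hu
    have h₂ : ¬ haltCode C w N 0 := by
      rintro ⟨⟨q, i, -, p, -, l, -, h, -, r, -, hu, -⟩, -⟩
      exact (encConfig_pos _ _ _ _ _ _).ne hu
    simp [configGraph, h₁, h₂]

end Machine

/-! ### Functions in `#L` are reducible to matrix powering -/

section
variable {a b : ℕ}

instance TermDef.pow {L : Collection} {f : NumFun a b} [TermDef L f] (k : ℕ) :
    TermDef L (fun x X => f x X ^ k) := by
  induction k with
  | zero => simp only [pow_zero]; infer_instance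
  | succ k ih => simp only [pow_succ]; infer_instance

instance PolyBounded.pow {f : NumFun a b} [PolyBounded f] (k : ℕ) :
    PolyBounded (fun x X => f x X ^ k) := by
  induction k with
  | zero => simp only [pow_zero]; infer_instance
  | succ k ih => simp only [pow_succ]; infer_instance

instance : PolyBounded (fun x X => (encodeInput (a := a) (b := b) x X).length) := by
  simp only [length_encodeInput]; infer_instance

instance {M : Machine} {C : M.Coding} {c : ℕ} {L : Collection} {f : NumFun a b} [TermDef L f] :
    TermDef L (fun x X => Machine.codeBound C c (f x X)) := by
  unfold Machine.codeBound; infer_instance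

instance {M : Machine} {C : M.Coding} {c : ℕ} {f : NumFun a b} [PolyBounded f] :
    PolyBounded (fun x X => Machine.codeBound C c (f x X)) := by
  unfold Machine.codeBound Machine.encConfig; infer_instance

/-- A number of walks in a `Σ₀ᴮ`-definable graph on polynomially many numbers is obtained in binary
from matrix powering. -/
theorem exists_definableSeq_of_walkCount {H : StrFun a b}
    {E : (Fin a → ℕ) → (Fin b → Str) → ℕ → ℕ → Prop} {N k u : NumFun a b}
    (hH : ∀ x X, bin (H x X) = walkCount (E x X) (N x X) (k x X) (u x X))
    (hu : ∀ x X, u x X < N x X) [PolyBounded N] [PolyBounded k]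
    (hN : ∀ L, TermDef L N) (hk : ∀ L, TermDef L k) (hu' : ∀ L, TermDef L u)
    (hE : ∀ L, ∀ {n' : ℕ} (ρ : Fin a → Fin n') (f g : NumFun n' b), TermDef L f → TermDef L g →
      RelDef L (fun x X => E (fun i => x (ρ i)) X (f x X) (g x X))) :
    ∃ Gs, DefinableSeq (Collection.single unaryMatrixPowering) Gs ∧ (⟨a, b, H⟩ : StrSym) ∈ Gs := by
  let Y : StrFun a b := fun x X => adjString (E x X) (N x X)
  have hY : StrDefinable ((Collection.single unaryMatrixPowering).adjoin []) Y := by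
    refine StrDefinable.of_relDef (fun x X => pair (N x X) (pair (N x X) 1) + 1)
      (fun x X i hi => lt_of_mem_adjString hi) ?_
    simp only [Y, mem_adjString]
    have := hN ((Collection.single unaryMatrixPowering).adjoin [])
    -- the number variables of the formula are the entry, the column, the row, the bit, and then
    -- the arguments
    have := hE ((Collection.single unaryMatrixPowering).adjoin [])
      (fun i => i.succ.succ.succ.succ) (fun z _ => z (Fin.succ (Fin.succ 0)))
      (fun z _ => z (Fin.succ 0)) inferInstance inferInstance
    infer_instance
  have hHdef : StrDefinable ((Collection.single unaryMatrixPowering).adjoin [⟨a, b, Y⟩]) H := by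
    set L := (Collection.single unaryMatrixPowering).adjoin [⟨a, b, Y⟩]
    have := hN L
    have := hk L
    have := hu' L
    have hb : PolyBounded (fun x X => N x X * k x X + 1) := inferInstance
    refine StrDefinable.of_relDef _ (hb := hb) (fun x X i hi => ?_) ?_
    · rw [← binStr_bin (H x X), hH] at hi
      exact lt_of_mem_binStr hi ((walkCount_le _ _ _ _).trans (pow_le_two_pow_mul _ _))
    · have hYt : StrTermDef L (fun (z : Fin (a + 1) → ℕ) X => Y (fun j => z j.succ) X) :=
        StrTermDef.app (F := Y) (show Y ∈ L.str a b from Or.inr List.mem_cons_self)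
          (fun j => TermDef.var j.succ) (fun j => StrTermDef.var j)
      have hF : StrTermDef L (fun (z : Fin (a + 1) → ℕ) X => unaryMatrixPowering
          ![N (fun j => z j.succ) X, k (fun j => z j.succ) X] ![Y (fun j => z j.succ) X]) :=
        StrTermDef.app (F := unaryMatrixPowering)
          (show unaryMatrixPowering ∈ L.str 2 1 from Or.inl rfl)
          (Fin.forall_fin_two.2 ⟨TermDef.rename Fin.succ (f := N),
            TermDef.rename Fin.succ (f := k)⟩)
          (Fin.forall_fin_one.2 hYt)
      refine RelDef.congr (R := fun z X => pair (u (fun j => z j.succ) X) (pair 0 (z 0)) ∈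
        unaryMatrixPowering ![N (fun j => z j.succ) X, k (fun j => z j.succ) X]
          ![Y (fun j => z j.succ) X]) (fun z X => ?_) inferInstance
      set x := fun j => z (Fin.succ j)
      have hN0 : 0 < N x X := (Nat.zero_le _).trans_lt (hu x X)
      rw [← binStr_bin (H x X), hH, ← adjMatrix_pow_apply _ hN0 _ ⟨u x X, hu x X⟩]
      simp only [unaryMatrixPowering, Matrix.cons_val_zero, Matrix.cons_val_one,
        Matrix.cons_val_fin_one, Y, unaryMatrix_adjString]
      exact pair_mem_encodeBinaryMatrix (A := adjMatrix (E x X) (N x X) ^ k x X) ⟨u x X, hu x X⟩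
        ⟨0, hN0⟩
  exact ⟨[⟨a, b, H⟩, ⟨a, b, Y⟩], ⟨hHdef, hY, trivial⟩, by simp⟩

/-- Every function in `#L` is obtained from matrix powering. -/
theorem IsSharpL.exists_definableSeq {H : StrFun a b} (h : IsSharpL H) :
    ∃ Gs, DefinableSeq (Collection.single unaryMatrixPowering) Gs ∧ (⟨a, b, H⟩ : StrSym) ∈ Gs := by
  obtain ⟨M, c, T, hM⟩ := h
  obtain ⟨C⟩ := M.nonempty_coding
  have hT := fun L => TermDef.polynomial (L := L) T (f := fun x X =>
    (encodeInput (a := a) (b := b) x X).length)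
  have := PolyBounded.polynomial T (f := fun x X => (encodeInput (a := a) (b := b) x X).length)
  have hpaths : ∀ (x : Fin a → ℕ) (X : Fin b → Str), PathsWithin (M.Step (encodeInput x X))
      (fun k => k.workPos.natAbs ≤ c * (Nat.log 2 (encodeInput x X).length + 1)) M.init
      (T.eval (encodeInput x X).length) := fun x X p hp hch => (hM x X).1 p ⟨hp, hch⟩
  refine exists_definableSeq_of_walkCount
    (E := fun x X => Machine.configGraph C (encodeInput x X)
      (Machine.codeBound C c (encodeInput x X).length))
    (N := fun x X => Machine.codeBound C c (encodeInput x X).length)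
    (k := fun x X => T.eval (encodeInput x X).length)
    (u := fun x X => Machine.encConfig (C.st M.start) 0 (c * ((encodeInput x X).length + 1)) 0 0 0)
    (fun x X => ?_) (fun x X => ?_) (fun L => inferInstance) hT (fun L => inferInstance) ?_
  · have := (hM x X).2
    rw [Machine.encard_acceptingPaths C (hpaths x X)] at this
    exact_mod_cast this.symm
  · exact Nat.lt_succ_of_le (pair_le_pair (Nat.succ_le_succ (C.st_lt _).le) (pair_le_pair
      (Nat.zero_le _) (pair_le_pair (Nat.le_mul_of_pos_left _ two_pos) (pair_le_pair (Nat.zero_le _)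
      (pair_le_pair (Nat.zero_le _) (Nat.zero_le _))))))
  · intro L n' ρ f g _ _
    infer_instance

end

namespace Walker

/-! ### A machine with a binary counter -/

/-- The control states of the walker. In `count` a run of ones is added to the counter; in `scan`
and `skip` the edges of the present block are inspected, `choose` being entered with the first bit
of a run; `pass`, `passFirst` and `passRun` move over a block that is jumped over. -/
inductive Ctl : Type
  | count
  | scan
  | choose
  | skip
  | pass
  | passFirst
  | passRun
  | done

/-- The states of the walker: the control states and the states of the counter routines. -/
inductive St : Type
  | ctl (q : Ctl)
  | inc
  | incRet
  | dec
  | decRet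
  | clear

instance : Finite Ctl :=
  Finite.of_injective (β := Fin 8)
    (fun | .count => 0 | .scan => 1 | .choose => 2 | .skip => 3 | .pass => 4 | .passFirst => 5
         | .passRun => 6 | .done => 7)
    (by rintro ⟨⟩ ⟨⟩ <;> simp)

instance : Finite St :=
  Finite.of_injective (β := Option (Option (Option (Option (Option Ctl)))))
    (fun | .ctl q => some (some (some (some (some q)))) | .inc => none | .incRet => some none
         | .dec => some (some none) | .decRet => some (some (some none))
         | .clear => some (some (some (some none))))
    (by rintro (_ | _ | _ | _ | _ | _) (_ | _ | _ | _ | _ | _) <;> simp)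

/-- The states that may be entered when a control state consumes an input symbol. Entering `inc`
increments the counter and returns to `count`; entering `dec` decrements it and goes to `pass`, or
goes to `scan` if it is `0`. -/
def next : Ctl → InputSymbol → List St
  | .count, .bit true => [.inc]
  | .count, .bit false => [.dec]
  | .count, .sep => [.dec]
  | .count, .leftEnd => [.ctl .count]
  | .scan, .bit false => [.ctl .scan]
  | .scan, .bit true => [.ctl .choose]
  | .choose, .bit true => [.ctl .skip, .ctl .count]
  | .choose, .sep => [.ctl .done]
  | .skip, .bit true => [.ctl .skip]
  | .skip, .bit false => [.ctl .scan]
  | .pass, .bit false => [.ctl .pass]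
  | .pass, .bit true => [.ctl .passFirst]
  | .passFirst, .bit false => [.dec]
  | .passFirst, .bit true => [.ctl .passRun]
  | .passRun, .bit true => [.ctl .passRun]
  | .passRun, .bit false => [.ctl .pass]
  | _, _ => []

theorem next_nodup (q : Ctl) (s : InputSymbol) : (next q s).Nodup := by
  rcases q with _ | _ | _ | _ | _ | _ | _ | _ <;> rcases s with (⟨⟨⟩⟩ | _ | _ | _) <;> simp [next]

/-- The transitions of the walker. The counter is written on the work tape in binary, the least
significant bit in cell `0`; between the routines the work head is on that cell. -/
def transitions : St → InputSymbol → Option Bool → List (St × Option Bool × Move × Move)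
  | .ctl q, s, g => (next q s).map fun σ => (σ, g, .right, .stay)
  | .inc, _, some true => [(.inc, some false, .stay, .right)]
  | .inc, _, _ => [(.incRet, some true, .stay, .left)]
  | .incRet, _, none => [(.ctl .count, none, .stay, .right)]
  | .incRet, _, g => [(.incRet, g, .stay, .left)]
  | .dec, _, some true => [(.decRet, some false, .stay, .left)]
  | .dec, _, some false => [(.dec, some true, .stay, .right)]
  | .dec, _, none => [(.clear, none, .stay, .left)]
  | .decRet, _, none => [(.ctl .pass, none, .stay, .right)]
  | .decRet, _, g => [(.decRet, g, .stay, .left)]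
  | .clear, _, none => [(.ctl .scan, none, .stay, .right)]
  | .clear, _, some _ => [(.clear, none, .stay, .left)]

/-- The walker: a machine that reads its input once from left to right, with a binary counter on the
work tape. -/
abbrev machine : Machine where
  State := St
  finState := inferInstance
  Symbol := Option Bool
  finSymbol := inferInstance
  start := .ctl .count
  accept := {.ctl .done}
  blank := none
  trans q s g q' g' d d' := (q', g', d, d') ∈ transitions q s g

/-! ### The counter -/

/-- The number with binary digits `ds`, least significant first. -/
def val : List Bool → ℕ
  | [] => 0
  | b :: ds => b.toNat + 2 * val ds

/-- Binary increment. -/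
def incr : List Bool → List Bool
  | [] => [true]
  | false :: ds => true :: ds
  | true :: ds => false :: incr ds

/-- Binary decrement, undefined for `0`. -/
def decr : List Bool → Option (List Bool)
  | [] => none
  | true :: ds => some (false :: ds)
  | false :: ds => (decr ds).map (true :: ·)

theorem val_incr (ds : List Bool) : val (incr ds) = val ds + 1 := by
  induction ds with
  | nil => rfl
  | cons b ds ih =>
    cases b
    · simp [incr, val]; omega
    · simp [incr, val, ih]; omega

theorem length_incr (ds : List Bool) :
    (incr ds).length = ds.length ∨
      (incr ds).length = ds.length + 1 ∧ val ds + 1 = 2 ^ ds.length := by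
  induction ds with
  | nil => simp [incr, val]
  | cons b ds ih =>
    cases b
    · simp [incr]
    · rcases ih with h | ⟨h, h'⟩
      · simp [incr, h]
      · right
        simp only [incr, List.length_cons, h, val, Bool.toNat_true, pow_succ, ← h', true_and]
        ring

theorem decr_eq_none {ds : List Bool} : decr ds = none ↔ val ds = 0 := by
  induction ds with
  | nil => simp [decr, val]
  | cons b ds ih => cases b <;> simp [decr, val, ih]

theorem decr_eq_some {ds ds' : List Bool} (h : decr ds = some ds') :
    val ds = val ds' + 1 ∧ ds'.length = ds.length := by
  induction ds generalizing ds' with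
  | nil => simp [decr] at h
  | cons b ds ih =>
    cases b
    · simp only [decr, Option.map_eq_some_iff] at h
      obtain ⟨a, ha, rfl⟩ := h
      obtain ⟨h₁, h₂⟩ := ih ha
      simp [val, h₁, h₂]; omega
    · simp only [decr, Option.some.injEq] at h
      subst h
      simp [val]; omega

/-- The work tape holding the digits `ds` in cells `0, 1, …`. -/
def tape (ds : List Bool) (z : ℤ) : Option Bool := if z < 0 then none else ds[z.toNat]?

theorem tape_append_cons (pre : List Bool) (b : Bool) (ds : List Bool) :
    tape (pre ++ b :: ds) pre.length = some b := by
  simp [tape]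

theorem tape_length (ds : List Bool) : tape ds ds.length = none := by
  simp [tape]

theorem tape_ne_none {ds : List Bool} {p : ℕ} (hp : p < ds.length) :
    ∃ b, tape ds p = some b := ⟨ds[p], by simp [tape, hp]⟩

theorem update_tape_cons (pre : List Bool) (b b' : Bool) (ds : List Bool) :
    Function.update (tape (pre ++ b :: ds)) (pre.length : ℤ) (some b') =
      tape (pre ++ b' :: ds) := by
  funext z
  by_cases hz : z = pre.length
  · subst hz; simp [tape]
  · rw [Function.update_of_ne hz]
    unfold tape
    split_ifs with h
    · rfl
    · rcases lt_trichotomy z.toNat pre.length with h' | h' | h'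
      · rw [List.getElem?_append_left h', List.getElem?_append_left h']
      · omega
      · obtain ⟨k, hk⟩ := Nat.exists_eq_add_of_lt h'
        rw [List.getElem?_append_right h'.le, List.getElem?_append_right h'.le,
          show z.toNat - pre.length = k + 1 by omega]
        rfl

theorem update_tape_length (ds : List Bool) (b : Bool) :
    Function.update (tape ds) (ds.length : ℤ) (some b) = tape (ds ++ [b]) := by
  funext z
  by_cases hz : z = ds.length
  · subst hz; simp [tape]
  · rw [Function.update_of_ne hz]
    unfold tape
    split_ifs with h
    · rfl
    · rw [List.getElem?_append]
      split_ifs with h'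
      · rfl
      · rw [List.getElem?_eq_none (not_lt.1 h'), List.getElem?_eq_none (by simp; omega)]

theorem update_tape_none (ds : List Bool) (b : Bool) :
    Function.update (tape (ds ++ [b])) (ds.length : ℤ) none = tape ds := by
  rw [← update_tape_length, Function.update_idem, ← tape_length ds, Function.update_eq_self]

/-! ### Runs of the machine -/

/-- The configuration with digits `ds` on the work tape. -/
def cfg (σ : St) (i : ℕ) (ds : List Bool) (p : ℤ) : machine.Config := ⟨σ, i, tape ds, p⟩

variable {w : List InputSymbol} {s : ℕ}

/-- All paths from `K` have at most `t` configurations, with the work head in `[-s, s]`, and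
exactly `N` of them are accepting. -/
def Runs (w : List InputSymbol) (s : ℕ) (K : machine.Config) (t N : ℕ) : Prop :=
  PathsWithin (machine.Step w) (fun k => k.workPos.natAbs ≤ s) K t ∧
    (accPaths (machine.Step w) {c | c.state ∈ machine.accept} K).encard = N

theorem Runs.mono {K : machine.Config} {t t' N : ℕ} (h : Runs w s K t N) (ht : t ≤ t') :
    Runs w s K t' N := ⟨h.1.mono ht, h.2⟩

theorem Runs.of_step {K K' : machine.Config} {t N : ℕ} (hs : K.workPos.natAbs ≤ s)
    (hK : ∀ K'', machine.Step w K K'' ↔ K'' = K') (h : Runs w s K' t N) :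
    Runs w s K (t + 1) N := by
  refine ⟨PathsWithin.of_step hs fun K'' hK'' => (hK K'').1 hK'' ▸ h.1, ?_⟩
  rw [encard_accPaths_of_step (S := {K'}) (by simpa using hK) (by simp), Finset.sum_singleton, h.2]

/-- A step of a counter routine. -/
theorem Runs.of_routine {σ σ' : St} {i : ℕ} {T : ℤ → Option Bool} {p : ℤ} {g : Option Bool}
    {d : Move} {t N : ℕ} (hi : i ≤ w.length + 1) (hp : p.natAbs ≤ s)
    (hσ : ∀ a, transitions σ a (T p) = [(σ', g, .stay, d)])
    (h : Runs w s ⟨σ', i, Function.update T p g, p + d.toInt⟩ t N) :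
    Runs w s ⟨σ, i, T, p⟩ (t + 1) N := by
  refine Runs.of_step hp (fun K => ?_) h
  constructor
  · rintro ⟨g', d₁, d', hτ, hd, -, hw, hp'⟩
    obtain ⟨q, i', T', p'⟩ := K
    change (q, g', d₁, d') ∈ transitions σ _ (T p) at hτ
    rw [hσ, List.mem_singleton] at hτ
    simp only [Prod.mk.injEq] at hτ
    obtain ⟨rfl, rfl, rfl, rfl⟩ := hτ
    simp only [Move.toInt, add_zero, Nat.cast_inj] at hd hw hp'
    subst hd hw hp'
    rfl
  · rintro rfl
    refine ⟨g, .stay, d, ?_, by simp [Move.toInt], hi, rfl, rfl⟩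
    change (σ', g, Move.stay, d) ∈ transitions σ _ (T p)
    rw [hσ, List.mem_singleton]

/-- Moving the work head back to cell `0` without changing the tape. -/
theorem Runs.rewind {σ : St} {q : Ctl}
    (hnone : ∀ a, transitions σ a none = [(.ctl q, none, .stay, .right)])
    (hsome : ∀ a b, transitions σ a (some b) = [(σ, some b, .stay, .left)])
    {i : ℕ} {ds : List Bool} {t N : ℕ} (hi : i ≤ w.length + 1) (hs : ds.length ≤ s) (hs' : 1 ≤ s)
    (h : Runs w s (cfg (.ctl q) i ds 0) t N) {p : ℕ} (hp : p ≤ ds.length) :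
    Runs w s (cfg σ i ds (p - 1)) (t + p + 1) N := by
  induction p with
  | zero =>
    have hblank : tape ds (-1) = none := rfl
    rw [show ((0 : ℕ) : ℤ) - 1 = -1 by norm_num]
    refine Runs.of_routine hi (by simpa using hs') (g := tape ds (-1)) (σ' := .ctl q) (d := .right)
      (fun a => by rw [hblank]; exact hnone a) ?_
    rw [Function.update_eq_self]
    exact h
  | succ p ih =>
    obtain ⟨b, hb⟩ := tape_ne_none (Nat.lt_of_succ_le hp)
    have hz : ((p + 1 : ℕ) : ℤ) - 1 = p := by push_cast; ring
    rw [hz]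
    refine (Runs.of_routine hi (by simp; omega) (σ' := σ) (g := tape ds p) (d := .left)
      (fun a => ?_) (?_ : Runs w s _ (t + p + 1) N)).mono (by omega)
    · rw [hb]; exact hsome a b
    · rw [Function.update_eq_self]
      exact ih (Nat.le_of_succ_le hp)

/-- Erasing the counter, from its last digit on. -/
theorem Runs.clear {i : ℕ} {t N : ℕ} (hi : i ≤ w.length + 1) (hs' : 1 ≤ s)
    (h : Runs w s (cfg (.ctl .scan) i [] 0) t N) (ds : List Bool) (hs : ds.length ≤ s) :
    Runs w s (cfg .clear i ds (ds.length - 1)) (t + ds.length + 1) N := by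
  induction ds using List.reverseRecOn with
  | nil =>
    refine Runs.of_routine hi (by simpa using hs') (g := tape [] (-1)) (fun _ => rfl) ?_
    rw [show (([] : List Bool).length : ℤ) - 1 = -1 by simp, Function.update_eq_self]
    exact h
  | append_singleton ds b ih =>
    rw [List.length_append, List.length_singleton] at hs ⊢
    have hz : ((ds.length + 1 : ℕ) : ℤ) - 1 = ds.length := by push_cast; ring
    rw [hz]
    refine (Runs.of_routine hi (by simp; omega) (σ' := .clear) (g := none) (d := .left)
      (fun _ => ?_) (?_ : Runs w s _ (t + ds.length + 1) N)).mono (by omega)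
    · rw [tape_append_cons]; rfl
    · rw [update_tape_none]
      exact ih (by omega)

/-- Incrementing the counter: `pre` are the digits that the carry has passed. -/
theorem Runs.inc {i : ℕ} {t N : ℕ} (hi : i ≤ w.length + 1) (hs' : 1 ≤ s) (ds pre : List Bool)
    (hs : (pre ++ ds).length ≤ s) (hs'' : (pre ++ incr ds).length ≤ s)
    (h : Runs w s (cfg (.ctl .count) i (pre ++ incr ds) 0) t N) :
    Runs w s (cfg .inc i (pre ++ ds) pre.length) (t + pre.length + 2 * ds.length + 2) N := by
  have hlen : pre.length ≤ s := by rw [List.length_append] at hs; omega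
  induction ds generalizing pre with
  | nil =>
    rw [List.append_nil]
    refine (Runs.of_routine hi (by simpa using hlen) (σ' := .incRet) (g := some true) (d := .left)
      (fun _ => ?_) (?_ : Runs w s _ (t + pre.length + 1) N)).mono (by simp)
    · rw [tape_length]; rfl
    · rw [update_tape_length]
      exact Runs.rewind (fun _ => rfl) (fun _ _ => rfl) hi hs'' hs' h (by simp)
  | cons b ds ih =>
    cases b
    · refine (Runs.of_routine hi (by simpa using hlen) (σ' := .incRet) (g := some true) (d := .left)
   (fun _ => ?_) (?_ : Runs w s _ (t + pre.length + 1) N)).mono (by simp)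
      · rw [tape_append_cons]; rfl
      · rw [update_tape_cons]
        exact Runs.rewind (fun _ => rfl) (fun _ _ => rfl) hi hs'' hs' h (by simp)
    · have := ih (pre ++ [false]) (by simpa using hs) (by simpa [incr] using hs'')
        (by simpa [incr] using h) (by simp at hs ⊢; omega)
      refine (Runs.of_routine hi (by simpa using hlen) (σ' := .inc) (g := some false) (d := .right)
        (fun _ => ?_) (?_ : Runs w s _ (t + (pre.length + 1) + 2 * ds.length + 2) N)).mono
        (by simp; omega)
      · rw [tape_append_cons]; rfl
      · rw [update_tape_cons]
        simpa [cfg, Move.toInt] using this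

/-- Decrementing a positive counter: `pre` are the digits that the borrow has passed. -/
theorem Runs.dec_of_some {i : ℕ} {t N : ℕ} (hi : i ≤ w.length + 1) (hs' : 1 ≤ s)
    (ds pre : List Bool) {ds' : List Bool} (hds : decr ds = some ds')
    (hs : (pre ++ ds).length ≤ s)
    (h : Runs w s (cfg (.ctl .pass) i (pre ++ ds') 0) t N) :
    Runs w s (cfg .dec i (pre ++ ds) pre.length) (t + pre.length + 2 * ds.length + 2) N := by
  have hlen : pre.length ≤ s := by rw [List.length_append] at hs; omega
  induction ds generalizing pre ds' with
  | nil => simp [decr] at hds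
  | cons b ds ih =>
    cases b
    · simp only [decr, Option.map_eq_some_iff] at hds
      obtain ⟨a, ha, rfl⟩ := hds
      have := ih (pre ++ [true]) ha (by simpa using hs) (by simpa using h)
        (by simp at hs ⊢; omega)
      refine (Runs.of_routine hi (by simpa using hlen) (σ' := .dec) (g := some true) (d := .right)
        (fun _ => ?_) (?_ : Runs w s _ (t + (pre.length + 1) + 2 * ds.length + 2) N)).mono
        (by simp; omega)
      · rw [tape_append_cons]; rfl
      · rw [update_tape_cons]
        simpa [cfg, Move.toInt] using this
    · simp only [decr, Option.some.injEq] at hds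
      subst hds
      refine (Runs.of_routine hi (by simpa using hlen) (σ' := .decRet) (g := some false)
        (d := .left)
        (fun _ => ?_) (?_ : Runs w s _ (t + pre.length + 1) N)).mono (by simp)
      · rw [tape_append_cons]; rfl
      · rw [update_tape_cons]
        exact Runs.rewind (fun _ => rfl) (fun _ _ => rfl) hi (by simpa using hs) hs' h (by simp)

/-- Decrementing a counter that is `0` erases it and returns to scanning. -/
theorem Runs.dec_of_none {i : ℕ} {t N : ℕ} (hi : i ≤ w.length + 1) (hs' : 1 ≤ s)
    (ds pre : List Bool) (hds : decr ds = none) (hs : (pre ++ ds).length ≤ s)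
    (h : Runs w s (cfg (.ctl .scan) i [] 0) t N) :
    Runs w s (cfg .dec i (pre ++ ds) pre.length) (t + pre.length + 2 * ds.length + 2) N := by
  have hlen : pre.length ≤ s := by rw [List.length_append] at hs; omega
  induction ds generalizing pre with
  | nil =>
    rw [List.append_nil]
    refine (Runs.of_routine hi (by simpa using hlen) (σ' := .clear) (g := tape pre pre.length)
      (d := .left)
      (fun _ => ?_) (?_ : Runs w s _ (t + pre.length + 1) N)).mono (by simp)
    · rw [tape_length]; rfl
    · rw [Function.update_eq_self]
      exact Runs.clear hi hs' h pre hlen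
  | cons b ds ih =>
    cases b
    · simp only [decr, Option.map_eq_none_iff] at hds
      have := ih (pre ++ [true]) hds (by simpa using hs) (by simp at hs ⊢; omega)
      refine (Runs.of_routine hi (by simpa using hlen) (σ' := .dec) (g := some true) (d := .right)
        (fun _ => ?_) (?_ : Runs w s _ (t + (pre.length + 1) + 2 * ds.length + 2) N)).mono
        (by simp; omega)
      · rw [tape_append_cons]; rfl
      · rw [update_tape_cons]
        simpa [cfg, Move.toInt] using this
    · simp [decr] at hds

theorem step_ctl_iff {q : Ctl} {i : ℕ} {ds : List Bool} (hi : i ≤ w.length) (K : machine.Config) :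
    machine.Step w (cfg (.ctl q) i ds 0) K ↔
      ∃ σ ∈ next q (Machine.readInput w i), K = cfg σ (i + 1) ds 0 := by
  constructor
  · rintro ⟨g', d₁, d', hτ, hd, -, hw, hp'⟩
    obtain ⟨q', i', T', p'⟩ := K
    change (q', g', d₁, d') ∈ transitions (.ctl q) _ (tape ds 0) at hτ
    simp only [transitions, List.mem_map, Prod.mk.injEq] at hτ
    obtain ⟨σ, hσ, rfl, rfl, rfl, rfl⟩ := hτ
    refine ⟨σ, hσ, ?_⟩
    simp only [cfg, Move.toInt, add_zero, Function.update_eq_self] at hd hw hp'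
    have : i' = i + 1 := by omega
    subst this hw hp'
    rfl
  · rintro ⟨σ, hσ, rfl⟩
    refine ⟨tape ds 0, .right, .stay, ?_, by simp [cfg, Move.toInt], Nat.succ_le_succ hi,
      (Function.update_eq_self _ _).symm, rfl⟩
    change _ ∈ transitions (.ctl q) _ (tape ds 0)
    simp only [transitions, List.mem_map, Prod.mk.injEq]
    exact ⟨σ, hσ, rfl, trivial⟩

/-- A control state without transitions halts, and accepts if it is `done`. -/
theorem Runs.of_next_eq_nil {q : Ctl} {i : ℕ} {ds : List Bool}
    (h : next q (Machine.readInput w i) = []) :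
    Runs w s (cfg (.ctl q) i ds 0) 1 (open Classical in if q = .done then 1 else 0) := by
  have hhalt : ∀ K, ¬ machine.Step w (cfg (.ctl q) i ds 0) K := by
    rintro K ⟨g', d₁, d', hτ, -⟩
    change _ ∈ transitions (.ctl q) _ (tape ds 0) at hτ
    simp only [transitions, List.mem_map] at hτ
    obtain ⟨σ, hσ, -⟩ := hτ
    change σ ∈ next q (Machine.readInput w i) at hσ
    simp [h] at hσ
  refine ⟨PathsWithin.of_halt hhalt (by simp [cfg]), ?_⟩
  split_ifs with hq
  · rw [accPaths_of_halt_of_mem hhalt (by subst hq; exact Set.mem_singleton _)]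
    simp
  · rw [accPaths_of_halt_of_notMem hhalt (fun h => hq (by
      have h : St.ctl q = St.ctl .done := h
      injection h))]
    simp

/-- The runs from a control state are those after its possible transitions. -/
theorem Runs.of_ctl {q : Ctl} {i : ℕ} {ds : List Bool} {t : ℕ} {f : St → ℕ} (hi : i ≤ w.length)
    (hne : next q (Machine.readInput w i) ≠ [])
    (h : ∀ σ ∈ next q (Machine.readInput w i), Runs w s (cfg σ (i + 1) ds 0) t (f σ)) :
    Runs w s (cfg (.ctl q) i ds 0) (t + 1) ((next q (Machine.readInput w i)).map f).sum := by
  classical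
  have hstep := fun K => step_ctl_iff (q := q) (ds := ds) hi K
  refine ⟨PathsWithin.of_step (by simp [cfg]) fun K hK => ?_, ?_⟩
  · obtain ⟨σ, hσ, rfl⟩ := (hstep K).1 hK
    exact (h σ hσ).1
  · rw [encard_accPaths_of_step
      (S := (next q (Machine.readInput w i)).toFinset.image fun σ => cfg σ (i + 1) ds 0)
      (fun K => by rw [hstep]; simp [eq_comm])
      (by
        obtain ⟨σ, hσ⟩ := List.exists_mem_of_ne_nil _ hne
        exact ⟨_, Finset.mem_image_of_mem _ (List.mem_toFinset.2 hσ)⟩),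
      Finset.sum_image (fun a _ b _ hab => congrArg Machine.Config.state hab),
      ← List.sum_toFinset _ (next_nodup _ _)]
    push_cast
    exact Finset.sum_congr rfl fun σ hσ => (h σ (List.mem_toFinset.1 hσ)).2

/-! ### The number of accepting runs -/

/-- Given the numbers `f q c` of accepting runs from control state `q` with counter `c`, the number
of accepting runs after entering the state `σ`. -/
def enter (f : Ctl → ℕ → ℕ) : St → ℕ → ℕ
  | .ctl q, c => f q c
  | .inc, c => f .count (c + 1)
  | .dec, 0 => f .scan 0
  | .dec, c + 1 => f .pass c
  | _, _ => 0

/-- The number of accepting runs from the control state `q` with counter `c` on the rest of the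
input. -/
def runCount : List InputSymbol → Ctl → ℕ → ℕ
  | _, .done, _ => 1
  | [], _, _ => 0
  | s :: w, q, c => ((next q s).map fun σ => enter (runCount w) σ c).sum

theorem runCount_cons {q : Ctl} (hq : q ≠ .done) (a : InputSymbol) (v : List InputSymbol) (c : ℕ) :
    runCount (a :: v) q c = ((next q a).map fun σ => enter (runCount v) σ c).sum := by
  cases q <;> first | rfl | exact absurd rfl hq

theorem next_mem {q : Ctl} {a : InputSymbol} {σ : St} (h : σ ∈ next q a) :
    (∃ q', σ = .ctl q') ∨ σ = .inc ∨ σ = .dec := by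
  rcases q with _ | _ | _ | _ | _ | _ | _ | _ <;> rcases a with (⟨⟨⟩⟩ | _ | _ | _) <;>
    simp only [next, List.mem_cons, List.not_mem_nil, or_false] at h <;>
    rcases h with h | h <;> simp_all

/-- The machine does what `runCount` says, in logarithmic space and polynomial time. -/
theorem runs_ctl {v pre : List InputSymbol} (hw : w = pre ++ v) {q : Ctl} {ds : List Bool}
    (hval : val ds + v.length ≤ w.length) (hds : ds.length ≤ Nat.log 2 w.length + 1) :
    Runs w (Nat.log 2 w.length + 1) (cfg (.ctl q) (pre.length + 1) ds 0)
      (v.length * (2 * w.length + 10) + 1) (runCount v q (val ds)) := by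
  induction v generalizing pre q ds with
  | nil =>
    have hread : Machine.readInput w (pre.length + 1) = .rightEnd := by
      simp [hw, Machine.readInput]
    have hnext : next q (Machine.readInput w (pre.length + 1)) = [] := by
      rw [hread]; cases q <;> rfl
    convert Runs.of_next_eq_nil hnext using 1
    · simp
    · cases q <;> simp [runCount]
  | cons a v ih =>
    have hread : Machine.readInput w (pre.length + 1) = a := by
      simp [hw, Machine.readInput]
    have hwlen : w.length = pre.length + (v.length + 1) := by simp [hw]
    rw [List.length_cons] at hval
    by_cases hnil : next q a = []
    · have := Runs.of_next_eq_nil (w := w) (s := Nat.log 2 w.length + 1) (q := q) (ds := ds)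
        (i := pre.length + 1) (by rw [hread, hnil])
      refine (show runCount (a :: v) q (val ds) = _ from ?_) ▸ this.mono (by simp)
      by_cases hq : q = .done
      · subst hq; rw [if_pos rfl]; rfl
      · rw [runCount_cons hq, hnil, if_neg hq]; rfl
    · have hq : q ≠ .done := by rintro rfl; exact hnil rfl
      rw [runCount_cons hq]
      have hpre : w = (pre ++ [a]) ++ v := by simp [hw]
      have hi : pre.length + 1 + 1 ≤ w.length + 1 := by omega
      have hlog : Nat.log 2 w.length ≤ w.length := Nat.log_le_self 2 _
      have key := Runs.of_ctl (s := Nat.log 2 w.length + 1) (ds := ds) (q := q)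
        (i := pre.length + 1) (w := w)
        (t := v.length * (2 * w.length + 10) + 1 + 0 + 2 * (Nat.log 2 w.length + 1) + 2)
        (f := fun σ => enter (runCount v) σ (val ds)) (by omega) (by rwa [hread])
        (fun σ hσ => ?_)
      · rw [hread] at key
        refine key.mono ?_
        rw [List.length_cons, Nat.succ_mul v.length]
        generalize v.length * (2 * w.length + 10) = y
        omega
      · have ih' := fun q' (ds' : List Bool) h₁ h₂ => ih hpre (q := q') (ds := ds') h₁ h₂
        simp only [List.length_append, List.length_singleton] at ih'
        rw [hread] at hσ
        rcases next_mem hσ with ⟨q', rfl⟩ | rfl | rfl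
        · exact (ih' q' ds (by omega) hds).mono (by omega)
        · have hlen : (incr ds).length ≤ Nat.log 2 w.length + 1 := by
            rcases length_incr ds with h | ⟨h, h'⟩
            · omega
            · rw [h]
              exact Nat.succ_le_succ (Nat.le_log_of_pow_le (by norm_num) (by omega))
          have := Runs.inc (t := v.length * (2 * w.length + 10) + 1)
            (N := runCount v .count (val ds + 1)) hi (Nat.succ_pos _) ds []
            (by simpa using hds) (by simpa using hlen)
            (by
              rw [← val_incr]
              exact ih' .count (incr ds) (by rw [val_incr]; omega) hlen)
          exact this.mono (by simp; omega)
        · cases hd : decr ds with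
          | none =>
            have h0 := decr_eq_none.1 hd
            rw [h0]
            have := Runs.dec_of_none (t := v.length * (2 * w.length + 10) + 1)
              (N := runCount v .scan 0) hi (Nat.succ_pos _) ds [] hd (by simpa using hds)
              (ih' .scan [] (by simp [val]; omega) (by simp))
            exact this.mono (by simp; omega)
          | some ds' =>
            obtain ⟨h₁, h₂⟩ := decr_eq_some hd
            rw [h₁]
            have := Runs.dec_of_some (t := v.length * (2 * w.length + 10) + 1)
              (N := runCount v .pass (val ds')) hi (Nat.succ_pos _) ds [] hd (by simpa using hds)
              (ih' .pass ds' (by omega) (by omega))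
            exact this.mono (by simp; omega)

/-- The number of accepting runs of the walker on `(x, X)`, in binary. -/
def walks : StrFun 1 1 := fun x X => binStr (runCount (encodeInput x X) .count 0)

theorem runs_init (w : List InputSymbol) :
    Runs w (Nat.log 2 w.length + 1) machine.init (w.length * (2 * w.length + 10) + 1 + 1)
      (runCount w .count 0) := by
  have hinit : machine.init = cfg (.ctl .count) 0 [] 0 := by
    have : (fun _ => none : ℤ → Option Bool) = tape [] := by funext z; simp [tape]
    simp only [Machine.init, cfg, ← this]
  have h := runs_ctl (w := w) (v := w) (pre := []) rfl (q := .count) (ds := []) (by simp [val])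
    (by simp)
  have := Runs.of_ctl (w := w) (s := Nat.log 2 w.length + 1) (q := .count) (ds := []) (i := 0)
    (f := fun _ => runCount w .count 0) (t := w.length * (2 * w.length + 10) + 1) (Nat.zero_le _)
    (by simp [Machine.readInput, next]) (by simpa [Machine.readInput, next, val] using h)
  rw [hinit]
  simpa [Machine.readInput, next] using this

theorem isSharpL_walks : IsSharpL walks := by
  refine ⟨machine, 1, .X * (.C 2 * .X + .C 10) + .C 2, fun x X => ⟨fun p hp => ?_, ?_⟩⟩
  · have := (runs_init (encodeInput x X)).1 p hp.1 hp.2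
    simpa [add_assoc] using this
  · rw [Machine.acceptingPaths_eq, (runs_init (encodeInput x X)).2, walks, bin_binStr]

/-! ### Runs of the walker on strings of slots -/

/-- A slot of width `W`: a run of `r` ones, padded with zeros. -/
def slot (W r : ℕ) : List InputSymbol :=
  List.replicate r (.bit true) ++ List.replicate (W - r) (.bit false)

/-- A sequence of slots given by the lengths of their runs, with an end mark that a scanning walker
accepts. -/
def slots (W : ℕ) (rs : List ℕ) : List InputSymbol :=
  rs.flatMap (slot W) ++ [.bit true, .sep]

theorem slots_cons (W r : ℕ) (rs : List ℕ) : slots W (r :: rs) = slot W r ++ slots W rs := by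
  simp [slots]

section
variable {v : List InputSymbol} {W c : ℕ}

theorem enter_ctl (f : Ctl → ℕ → ℕ) (q : Ctl) (c : ℕ) : enter f (.ctl q) c = f q c := rfl

theorem runCount_count_ones (r c : ℕ) :
    runCount (List.replicate r (.bit true) ++ v) .count c = runCount v .count (c + r) := by
  induction r generalizing c with
  | zero => rfl
  | succ r ih =>
    rw [List.replicate_succ, List.cons_append, runCount_cons (by simp)]
    simp [next, enter, ih, Nat.add_comm, Nat.add_left_comm]

theorem runCount_scan_zeros (z : ℕ) :
    runCount (List.replicate z (.bit false) ++ v) .scan c = runCount v .scan c := by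
  induction z with
  | zero => rfl
  | succ z ih =>
    rw [List.replicate_succ, List.cons_append, runCount_cons (by simp)]
    simp [next, enter, ih]

theorem runCount_pass_zeros (z : ℕ) :
    runCount (List.replicate z (.bit false) ++ v) .pass c = runCount v .pass c := by
  induction z with
  | zero => rfl
  | succ z ih =>
    rw [List.replicate_succ, List.cons_append, runCount_cons (by simp)]
    simp [next, enter, ih]

theorem runCount_skip_ones (r : ℕ) :
    runCount (List.replicate r (.bit true) ++ v) .skip c = runCount v .skip c := by
  induction r with
  | zero => rfl
  | succ r ih =>
    rw [List.replicate_succ, List.cons_append, runCount_cons (by simp)]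
    simp [next, enter, ih]

theorem runCount_passRun_ones (r : ℕ) :
    runCount (List.replicate r (.bit true) ++ v) .passRun c = runCount v .passRun c := by
  induction r with
  | zero => rfl
  | succ r ih =>
    rw [List.replicate_succ, List.cons_append, runCount_cons (by simp)]
    simp [next, enter, ih]

theorem enter_dec_zeros (z d : ℕ) :
    enter (runCount (List.replicate z (.bit false) ++ v)) .dec d = enter (runCount v) .dec d := by
  cases d <;> simp [enter, runCount_scan_zeros, runCount_pass_zeros]

/-- Scanning a slot: a run of length `0` is no edge, a run of length `1` ends the block, where the
scan fails, and a longer run is an edge, which may be skipped or taken. In the latter case the first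
two ones of the run are not counted. -/
theorem runCount_scan_slot {r : ℕ} (hr : r < W) :
    runCount (slot W r ++ v) .scan 0 =
      if r = 0 then runCount v .scan 0 else if r = 1 then 0 else
        runCount v .scan 0 + enter (runCount v) .dec (r - 2) := by
  obtain ⟨z, hz⟩ : ∃ z, W - r = z + 1 := ⟨W - r - 1, by omega⟩
  unfold slot
  rw [hz]
  match r with
  | 0 => simp [runCount_scan_zeros]
  | 1 =>
    simp only [List.replicate_succ, List.replicate_zero, List.cons_append, List.nil_append]
    rw [runCount_cons (by simp)]
    simp only [next, List.map_cons, List.map_nil, List.sum_cons, List.sum_nil, enter_ctl, add_zero]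
    rw [runCount_cons (by simp)]
    simp [next]
  | r + 2 =>
    simp only [List.replicate_succ (n := r + 1), List.replicate_succ (n := r), List.cons_append]
    rw [runCount_cons (by simp)]
    simp only [next, List.map_cons, List.map_nil, List.sum_cons, List.sum_nil, enter_ctl, add_zero]
    rw [runCount_cons (by simp)]
    simp only [next, List.map_cons, List.map_nil, List.sum_cons, List.sum_nil, enter_ctl, add_zero]
    rw [List.append_assoc, runCount_skip_ones, runCount_count_ones, List.replicate_succ,
      List.cons_append, runCount_cons (by simp), runCount_cons (by simp)]
    simp [next, enter_dec_zeros, enter_ctl, runCount_scan_zeros]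

/-- Passing a slot: only the ends of blocks are counted. -/
theorem runCount_pass_slot {r : ℕ} (hr : r < W) :
    runCount (slot W r ++ v) .pass c =
      if r = 1 then enter (runCount v) .dec c else runCount v .pass c := by
  obtain ⟨z, hz⟩ : ∃ z, W - r = z + 1 := ⟨W - r - 1, by omega⟩
  unfold slot
  rw [hz]
  match r with
  | 0 => simp [runCount_pass_zeros]
  | 1 =>
    simp only [List.replicate_succ, List.replicate_zero, List.cons_append, List.nil_append]
    rw [runCount_cons (by simp)]
    simp only [next, List.map_cons, List.map_nil, List.sum_cons, List.sum_nil, enter_ctl, add_zero]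
    rw [runCount_cons (by simp)]
    simp [next, enter_dec_zeros]
  | r + 2 =>
    simp only [List.replicate_succ (n := r + 1), List.replicate_succ (n := r), List.cons_append]
    rw [runCount_cons (by simp)]
    simp only [next, List.map_cons, List.map_nil, List.sum_cons, List.sum_nil, enter_ctl, add_zero]
    rw [runCount_cons (by simp)]
    simp only [next, List.map_cons, List.map_nil, List.sum_cons, List.sum_nil, enter_ctl, add_zero]
    rw [List.append_assoc, runCount_passRun_ones, List.replicate_succ, List.cons_append,
      runCount_cons (by simp)]
    simp [next, enter, runCount_pass_zeros]

end

section
variable {W : ℕ}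

/-- The number of accepting runs that scan the slots `rs`. -/
def scanCount (W : ℕ) (rs : List ℕ) : ℕ := runCount (slots W rs) .scan 0

/-- The number of accepting runs that jump over `d` ends of blocks in `rs` and then scan. -/
def jumpCount (W : ℕ) (rs : List ℕ) (d : ℕ) : ℕ := enter (runCount (slots W rs)) .dec d

theorem scanCount_nil : scanCount W [] = 1 := by
  simp [scanCount, slots, runCount, next, enter]

theorem scanCount_cons {r : ℕ} {rs : List ℕ} (hr : r < W) :
    scanCount W (r :: rs) = if r = 0 then scanCount W rs else if r = 1 then 0 else
      scanCount W rs + jumpCount W rs (r - 2) := by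
  rw [scanCount, slots_cons, runCount_scan_slot hr]; rfl

theorem jumpCount_cons {r : ℕ} {rs : List ℕ} (hr : r < W) (d : ℕ) :
    jumpCount W (r :: rs) (d + 1) =
      if r = 1 then jumpCount W rs d else jumpCount W rs (d + 1) := by
  rw [jumpCount, slots_cons]
  exact runCount_pass_slot hr

theorem jumpCount_block (hW : 1 < W) {l rs : List ℕ} (hl : ∀ r ∈ l, r < W ∧ r ≠ 1) (d : ℕ) :
    jumpCount W (l ++ 1 :: rs) (d + 1) = jumpCount W rs d := by
  induction l with
  | nil => rw [List.nil_append, jumpCount_cons hW, if_pos rfl]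
  | cons r l ih =>
    have := hl r List.mem_cons_self
    rw [List.cons_append, jumpCount_cons this.1, if_neg this.2,
      ih fun r hr => hl r (List.mem_cons_of_mem _ hr)]

/-- Scanning a block ends with the choice of one of its edges; the end of this block is the first
one to be passed. -/
theorem scanCount_block (hW : 1 < W) {l rs : List ℕ}
    (hl : ∀ r ∈ l, r < W ∧ (r = 0 ∨ 3 ≤ r)) :
    scanCount W (l ++ 1 :: rs) =
      (l.map fun r => if r = 0 then 0 else jumpCount W rs (r - 3)).sum := by
  induction l with
  | nil => rw [List.nil_append, scanCount_cons hW]; simp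
  | cons r l ih =>
    have hl' : ∀ r ∈ l, r < W ∧ (r = 0 ∨ 3 ≤ r) := fun r hr => hl r (List.mem_cons_of_mem _ hr)
    obtain ⟨h₁, h₂⟩ := hl r List.mem_cons_self
    rw [List.cons_append, scanCount_cons h₁, ih hl', List.map_cons, List.sum_cons]
    rcases h₂ with rfl | h₂
    · simp
    · rw [if_neg (by omega), if_neg (by omega), if_neg (by omega), add_comm,
        show r - 2 = r - 3 + 1 by omega,
        jumpCount_block hW fun r hr => ⟨(hl' r hr).1, by have := (hl' r hr).2; omega⟩]

/-- A block with `S` slots, given by the lengths of their runs, and the slot that ends the block. -/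
def block (S : ℕ) (f : ℕ → ℕ) : List ℕ := (List.range S).map f ++ [1]

/-- The slots of the blocks `b, …, B - 1`. -/
def blocksFrom (S : ℕ) (f : ℕ → ℕ → ℕ) (B b : ℕ) : List ℕ :=
  (List.range' b (B - b)).flatMap fun b => block S (f b)

theorem blocksFrom_self (S : ℕ) (f : ℕ → ℕ → ℕ) (B : ℕ) : blocksFrom S f B B = [] := by
  simp [blocksFrom]

theorem blocksFrom_of_lt {S : ℕ} {f : ℕ → ℕ → ℕ} {B b : ℕ} (h : b < B) :
    blocksFrom S f B b = (List.range S).map (f b) ++ 1 :: blocksFrom S f B (b + 1) := by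
  obtain ⟨m, hm⟩ : ∃ m, B - b = m + 1 := ⟨B - b - 1, by omega⟩
  rw [blocksFrom, hm, List.range'_succ, List.flatMap_cons, block, blocksFrom,
    show B - (b + 1) = m by omega]
  simp

theorem jumpCount_blocksFrom (hW : 1 < W) {S : ℕ} {f : ℕ → ℕ → ℕ} {B : ℕ}
    (hf : ∀ b < B, ∀ s < S, f b s < W ∧ (f b s = 0 ∨ 3 ≤ f b s)) {d b : ℕ} (h : b + d ≤ B) :
    jumpCount W (blocksFrom S f B b) d = scanCount W (blocksFrom S f B (b + d)) := by
  induction d generalizing b with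
  | zero => rfl
  | succ d ih =>
    rw [blocksFrom_of_lt (by omega), jumpCount_block hW, ih (by omega),
      show b + 1 + d = b + (d + 1) by omega]
    simp only [List.mem_map, List.mem_range]
    rintro _ ⟨s, hs, rfl⟩
    have := hf b (by omega) s hs
    omega

/-- From the beginning of a block, the walker continues with each of the blocks that the edges of
the block lead to. -/
theorem scanCount_blocksFrom (hW : 1 < W) {S : ℕ} {f : ℕ → ℕ → ℕ} {B : ℕ}
    (hf : ∀ b < B, ∀ s < S, f b s < W ∧ (f b s = 0 ∨ 3 ≤ f b s ∧ b + (f b s - 2) ≤ B))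
    {b : ℕ} (hb : b < B) :
    scanCount W (blocksFrom S f B b) = ∑ s ∈ Finset.range S,
      if f b s = 0 then 0 else scanCount W (blocksFrom S f B (b + (f b s - 2))) := by
  have hf' : ∀ b < B, ∀ s < S, f b s < W ∧ (f b s = 0 ∨ 3 ≤ f b s) := fun b hb s hs =>
    ⟨(hf b hb s hs).1, (hf b hb s hs).2.imp_right And.left⟩
  rw [blocksFrom_of_lt hb, scanCount_block hW, List.map_map]
  · change ∑ s ∈ Finset.range S, _ = _
    refine Finset.sum_congr rfl fun s hs => ?_
    have := hf b hb s (Finset.mem_range.1 hs)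
    simp only [Function.comp_apply]
    split_ifs with h
    · rfl
    · rw [jumpCount_blocksFrom hW hf' (by omega),
        show b + 1 + (f b s - 3) = b + (f b s - 2) by omega]
  · simp only [List.mem_map, List.mem_range]
    rintro _ ⟨s, hs, rfl⟩
    exact hf' b hb s hs

end

/-! ### Strings of slots -/

theorem map_range_mul {α : Type*} (f : ℕ → α) (a W : ℕ) :
    (List.range (a * W)).map f =
      (List.range a).flatMap fun e => (List.range W).map fun o => f (e * W + o) := by
  induction a with
  | zero => simp
  | succ a ih =>
    rw [Nat.succ_mul, List.range_add, List.map_append, ih, List.range_succ, List.flatMap_append]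
    simp [Function.comp_def]

theorem slot_eq {W r : ℕ} (hr : r ≤ W) :
    slot W r = (List.range W).map fun o => .bit (decide (o < r)) := by
  obtain ⟨z, rfl⟩ := Nat.exists_eq_add_of_le hr
  rw [List.range_add, List.map_append, slot, Nat.add_sub_cancel_left]
  congr 1
  · refine (List.eq_replicate_iff.2 ⟨by simp, ?_⟩).symm
    simp only [List.mem_map, List.mem_range]
    rintro _ ⟨o, ho, rfl⟩
    simp [ho]
  · refine (List.eq_replicate_iff.2 ⟨by simp, ?_⟩).symm
    simp only [List.mem_map, List.mem_range]
    rintro _ ⟨_, ⟨o, ho, rfl⟩, rfl⟩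
    simp

/-- The length of the run in slot `e`, if each block has `S` slots and an end slot. -/
def runLength (S : ℕ) (f : ℕ → ℕ → ℕ) (e : ℕ) : ℕ :=
  if e % (S + 1) = S then 1 else f (e / (S + 1)) (e % (S + 1))

theorem map_runLength (S : ℕ) (f : ℕ → ℕ → ℕ) (B : ℕ) :
    (List.range (B * (S + 1))).map (runLength S f) = blocksFrom S f B 0 := by
  rw [map_range_mul, blocksFrom, Nat.sub_zero, ← List.range_eq_range']
  refine List.flatMap_congr fun b _ => ?_
  rw [List.range_succ, List.map_append, block]
  congr 1
  · refine List.map_congr_left fun s hs => ?_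
    have hs := List.mem_range.1 hs
    rw [runLength, mul_comm b, Nat.mul_add_mod, Nat.mul_add_div S.succ_pos,
      Nat.mod_eq_of_lt (by omega), Nat.div_eq_of_lt (by omega), if_neg hs.ne, add_zero]
  · rw [List.map_singleton, runLength, mul_comm b, Nat.mul_add_mod,
      Nat.mod_eq_of_lt (Nat.lt_succ_self S), if_pos rfl]

/-- A string whose bits are those of a sequence of slots: the top bit is the first symbol of the end
mark, and the separator is the second one. -/
theorem encodeStr_eq_slots {Y : Str} {S W B : ℕ} {f : ℕ → ℕ → ℕ} (hW : 1 < W)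
    (hf : ∀ b < B, ∀ s < S, f b s < W)
    (hY : ∀ p, p ∈ Y ↔ p = B * (S + 1) * W ∨
      p / W < B * (S + 1) ∧ p % W < runLength S f (p / W)) :
    encodeStr Y = slots W (blocksFrom S f B 0) := by
  set R := B * (S + 1)
  have hlt : ∀ p, p / W < R ↔ p < R * W := fun p => Nat.div_lt_iff_lt_mul (by omega)
  have hlen : len Y = R * W + 1 := by
    refine le_antisymm (len_le fun p hp => ?_) (lt_len ((hY _).2 (Or.inl rfl)))
    rcases (hY p).1 hp with rfl | h
    · exact Nat.lt_succ_self _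
    · exact ((hlt p).1 h.1).trans (Nat.lt_succ_self _)
  rw [encodeStr, hlen, List.range_succ, List.map_append, slots, ← map_runLength, List.flatMap_map,
    List.append_assoc]
  congr 1
  · rw [map_range_mul]
    refine List.flatMap_congr fun e he => ?_
    have he : e < R := List.mem_range.1 he
    have hr : runLength S f e ≤ W := by
      unfold runLength
      split_ifs with h
      · exact hW.le
      · have h₁ : e % (S + 1) < S + 1 := Nat.mod_lt e S.succ_pos
        exact (hf _ ((Nat.div_lt_iff_lt_mul S.succ_pos).2 he) _ (by omega)).le
    rw [slot_eq hr]
    refine List.map_congr_left fun o ho => ?_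
    have ho := List.mem_range.1 ho
    have h₁ : (e * W + o) / W = e := by
      rw [mul_comm, Nat.mul_add_div (by omega), Nat.div_eq_of_lt ho, add_zero]
    have h₂ : (e * W + o) % W = o := by
      rw [mul_comm, Nat.mul_add_mod, Nat.mod_eq_of_lt ho]
    have h₃ : e * W + o < R * W := (hlt _).1 (by rwa [h₁])
    congr 2
    rw [hY, h₁, h₂]
    simp [he, h₃.ne]
  · simp [hY]

theorem encodeInput_one_one (i : ℕ) (Y : Str) :
    encodeInput ![i] ![Y] = List.replicate i (.bit true) ++ .sep :: encodeStr Y := by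
  simp [encodeInput, encodeNum]

/-- On a sequence of slots, the walker starts in the block given by the number argument. -/
theorem mem_walks_iff {Y : Str} {S W B : ℕ} {f : ℕ → ℕ → ℕ} (hW : 1 < W)
    (hf : ∀ b < B, ∀ s < S, f b s < W ∧ (f b s = 0 ∨ 3 ≤ f b s))
    (hY : ∀ p, p ∈ Y ↔ p = B * (S + 1) * W ∨
      p / W < B * (S + 1) ∧ p % W < runLength S f (p / W)) {i : ℕ} (hi : i ≤ B) :
    walks ![i] ![Y] = binStr (scanCount W (blocksFrom S f B i)) := by
  rw [walks, encodeInput_one_one, encodeStr_eq_slots hW (fun b hb s hs => (hf b hb s hs).1) hY,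
    runCount_count_ones, runCount_cons (by simp), ← Nat.zero_add i,
    ← jumpCount_blocksFrom hW hf (by omega)]
  simp [next, jumpCount]

end Walker

/-! ### Unary entries -/

theorem len_row_le (x : ℕ) (Z : Str) : len (row x Z) ≤ len Z :=
  len_le fun i hi => (le_pair_right x i).trans_lt (lt_len (mem_row.1 hi))

theorem seq_le (x : ℕ) (Z : Str) : seq x Z ≤ len Z := by
  rw [seq]
  split_ifs with h
  · exact (Nat.find_spec h).1.le
  · exact le_rfl

theorem entry_le (i j : ℕ) (X : Str) : entry i j X ≤ len X :=
  (seq_le _ _).trans (len_row_le _ _)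

theorem lt_seq_iff {x y : ℕ} {Z : Str} :
    y < seq x Z ↔ y < len Z ∧ ∀ z, z ≤ y → pair x z ∉ Z := by
  rw [seq]
  split_ifs with h
  · rw [Nat.lt_find_iff]
    constructor
    · intro hy
      have hlen : y < len Z := by
        refine lt_of_not_ge fun hle => ?_
        exact hy _ ((Nat.find_spec h).1.le.trans hle) (Nat.find_spec h)
      exact ⟨hlen, fun z hz hp => hy z hz ⟨hz.trans_lt hlen, hp⟩⟩
    · exact fun hy z hz hp => hy.2 z hz hp.2
  · exact ⟨fun hy => ⟨hy, fun z hz hp => h ⟨z, hz.trans_lt hy, hp⟩⟩, And.left⟩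

theorem lt_entry_iff {i j y : ℕ} {X : Str} :
    y < entry i j X ↔ (∃ z, z < len X ∧ (y ≤ z ∧ pair i z ∈ X)) ∧
      ∀ z, z ≤ y → ¬ pair i (pair j z) ∈ X := by
  rw [entry, lt_seq_iff]
  simp only [mem_row]
  refine and_congr_left fun _ => ⟨fun h => ?_, ?_⟩
  · obtain ⟨z, hz, hy⟩ := exists_mem_of_lt_len h
    rw [mem_row] at hz
    exact ⟨z, (le_pair_right i z).trans_lt (lt_len hz), hy, hz⟩
  · rintro ⟨z, -, hy, hz⟩
    exact hy.trans_lt (lt_len (mem_row.2 hz))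

instance {L : Collection} {n m : ℕ} {f i j : NumFun n m} {F : StrFun n m} [TermDef L f]
    [TermDef L i] [TermDef L j] [StrTermDef L F] :
    RelDef L (fun x X => f x X < entry (i x X) (j x X) (F x X)) := by
  simp only [lt_entry_iff]
  infer_instance

theorem pow_apply_le {n m : ℕ} {A : Matrix (Fin n) (Fin n) ℕ} (hA : ∀ i j, A i j ≤ m) (k : ℕ)
    (i j : Fin n) : (A ^ k) i j ≤ (n * m) ^ k := by
  induction k generalizing i with
  | zero => rw [pow_zero, pow_zero, Matrix.one_apply]; split_ifs <;> simp
  | succ k ih =>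
    rw [pow_succ', Matrix.mul_apply]
    refine (Finset.sum_le_card_nsmul _ _ (m * (n * m) ^ k) fun l _ =>
      Nat.mul_le_mul (hA i l) (ih l)).trans ?_
    rw [Finset.card_univ, Fintype.card_fin, smul_eq_mul, pow_succ', mul_assoc]

/-- Matrix powering is p-bounded. -/
theorem lt_of_mem_unaryMatrixPowering {x : Fin 2 → ℕ} {X : Fin 1 → Str} {b : ℕ}
    (h : b ∈ unaryMatrixPowering x X) :
    b < pair (x 0) (pair (x 0) (x 0 * len (X 0) * x 1 + 1)) + 1 := by
  obtain ⟨i, j, l, hl, rfl⟩ := mem_encodeBinaryMatrix.1 h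
  have := lt_of_mem_binStr hl
    ((pow_apply_le (fun i j => entry_le i j (X 0)) _ _ _).trans (pow_le_two_pow_mul _ _))
  exact Nat.lt_succ_of_le (pair_le_pair i.2.le (pair_le_pair j.2.le this.le))

/-! ### A layered graph for matrix powers -/

section
variable (n k j : ℕ) (X : Str)

/-- In the layered graph for the `k`-th power of the `n × n` matrix encoded by `X`, the node `u` of
layer `t` has an edge with index `(v, y)`: for each `y` below the entry `(u, v)` there is an edge to
the node `v` of layer `t + 1`, and the node `j` of layer `k` has one edge to the exit. -/
def HasEdge (t u v y : ℕ) : Prop :=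
  (t < k ∧ y < entry u v X) ∨ (t = k ∧ u = j ∧ v = 0 ∧ y = 0)

open Classical in
/-- The run in slot `s = v * (len X + 1) + y` of block `b = t * n + u`: the edge with index `(v, y)`
leads from block `b` to block `(t + 1) * n + v`, so that `n - u + v` blocks are passed. -/
noncomputable def edgeRun (b s : ℕ) : ℕ :=
  if HasEdge k j X (b / n) (b % n) (s / (len X + 1)) (s % (len X + 1)) then
    n - b % n + s / (len X + 1) + 2 else 0

/-- The number of slots in a block. -/
def slotNum : ℕ := n * (len X + 1)

/-- The bits of the string of slots that represents the layered graph. There are `k + 1` layers of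
`n` blocks, each with `slotNum n X` slots and an end slot, and slots have width `2 * n + 3`, which
exceeds all runs. Bit `p` is bit `o` of slot `e`, which is slot `s` of block `b`; the last bit
belongs to the end mark. Quotients and remainders are expressed by bounded quantifiers. -/
def SlotBit (p : ℕ) : Prop :=
  p = (k + 1) * n * (slotNum n X + 1) * (2 * n + 3) ∨
    ∃ e, e ≤ p ∧ ∃ o, o ≤ p ∧ (p = e * (2 * n + 3) + o ∧ o < 2 * n + 3 ∧
      (e < (k + 1) * n * (slotNum n X + 1) ∧
      ∃ b, b ≤ e ∧ ∃ s, s ≤ e ∧ (e = b * (slotNum n X + 1) + s ∧ s < slotNum n X + 1 ∧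
        ((s = slotNum n X ∧ o < 1) ∨ (s < slotNum n X ∧
          ∃ t, t ≤ b ∧ ∃ u, u ≤ b ∧ (b = t * n + u ∧ u < n ∧
            ∃ v, v ≤ s ∧ ∃ y, y ≤ s ∧ (s = v * (len X + 1) + y ∧ y < len X + 1 ∧
              (HasEdge k j X t u v y ∧ o + u < n + v + 2))))))))

end

/-- Bounded quantification over quotient and remainder. -/
theorem exists_div_mod_iff {e d : ℕ} (hd : 0 < d) {P : ℕ → ℕ → Prop} :
    (∃ q, q ≤ e ∧ ∃ r, r ≤ e ∧ (e = q * d + r ∧ r < d ∧ P q r)) ↔ P (e / d) (e % d) := by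
  constructor
  · rintro ⟨q, -, r, -, rfl, hr, h⟩
    rwa [mul_comm, Nat.mul_add_div hd, Nat.mul_add_mod, Nat.div_eq_of_lt hr, Nat.mod_eq_of_lt hr,
      add_zero]
  · exact fun h => ⟨_, Nat.div_le_self e d, _, Nat.mod_le e d, (Nat.div_add_mod' e d).symm,
      Nat.mod_lt e hd, h⟩

theorem slotBit_iff {n k j p : ℕ} {X : Str} :
    SlotBit n k j X p ↔ p = (k + 1) * n * (slotNum n X + 1) * (2 * n + 3) ∨
      p / (2 * n + 3) < (k + 1) * n * (slotNum n X + 1) ∧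
        p % (2 * n + 3) < Walker.runLength (slotNum n X) (edgeRun n k j X) (p / (2 * n + 3)) := by
  rw [SlotBit, exists_div_mod_iff (by omega)]
  refine or_congr_right (and_congr_right fun he => ?_)
  rw [exists_div_mod_iff (by omega)]
  set e := p / (2 * n + 3)
  set o := p % (2 * n + 3)
  have hn : 0 < n := by
    rcases Nat.eq_zero_or_pos n with rfl | h
    · simp at he
    · exact h
  have hs : e % (slotNum n X + 1) < slotNum n X + 1 := Nat.mod_lt _ (Nat.succ_pos _)
  rw [Walker.runLength]
  split_ifs with h
  · simp [h]
  · rw [exists_div_mod_iff hn, exists_div_mod_iff (by omega), edgeRun]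
    set u := e / (slotNum n X + 1) % n
    have hu : u < n := Nat.mod_lt _ hn
    split_ifs with h'
    · simp only [h, h', false_and, true_and, false_or]
      omega
    · simp only [h, h', false_and, and_false, or_false, Nat.not_lt_zero]

/-- The string of slots that represents the layered graph for the `(·, j)`-entries of the `k`-th
power of the `n × n` matrix encoded by `X`. -/
noncomputable def slotStr : StrFun 3 1 := fun x X =>
  open Classical in
  (Finset.range ((x 1 + 1) * x 0 * (slotNum (x 0) (X 0) + 1) * (2 * x 0 + 3) + 1)).filter
    fun p => SlotBit (x 0) (x 1) (x 2) (X 0) p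

theorem mem_slotStr {x : Fin 3 → ℕ} {X : Fin 1 → Str} {p : ℕ} :
    p ∈ slotStr x X ↔ SlotBit (x 0) (x 1) (x 2) (X 0) p := by
  simp only [slotStr, Finset.mem_filter, Finset.mem_range, and_iff_right_iff_imp]
  intro h
  rcases slotBit_iff.1 h with rfl | h
  · exact Nat.lt_succ_self _
  · exact ((Nat.div_lt_iff_lt_mul (by omega)).1 h.1).trans (Nat.lt_succ_self _)

instance {L : Collection} {a b : ℕ} {n : NumFun a b} {X : StrFun a b} [TermDef L n]
    [StrTermDef L X] : TermDef L (fun x Z => slotNum (n x Z) (X x Z)) := by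
  unfold slotNum; infer_instance

instance {L : Collection} {a b : ℕ} {k j t u v y : NumFun a b} {X : StrFun a b} [TermDef L k]
    [TermDef L j] [TermDef L t] [TermDef L u] [TermDef L v] [TermDef L y] [StrTermDef L X] :
    RelDef L (fun x Z => HasEdge (k x Z) (j x Z) (X x Z) (t x Z) (u x Z) (v x Z) (y x Z)) := by
  unfold HasEdge; infer_instance

-- the instance that describes the formula for `SlotBit` is a large term
set_option synthInstance.maxSize 1000 in
set_option synthInstance.maxHeartbeats 200000 in
theorem strDefinable_slotStr (L : Collection) : StrDefinable L slotStr := by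
  have hb : PolyBounded (fun (x : Fin 3 → ℕ) (X : Fin 1 → Str) =>
      (x 1 + 1) * x 0 * (x 0 * (len (X 0) + 1) + 1) * (2 * x 0 + 3) + 1) := inferInstance
  refine StrDefinable.of_relDef _ (hb := hb) (fun x X i hi => ?_) ?_
  · simp only [slotStr, Finset.mem_filter, Finset.mem_range] at hi
    exact hi.1
  simp only [mem_slotStr, SlotBit]
  infer_instance

theorem sum_range_mul (f : ℕ → ℕ) (n m : ℕ) :
    ∑ s ∈ Finset.range (n * m), f s =
      ∑ v ∈ Finset.range n, ∑ y ∈ Finset.range m, f (v * m + y) := by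
  induction n with
  | zero => simp
  | succ n ih => rw [Nat.succ_mul, Finset.sum_range_add, ih, Finset.sum_range_succ]

section
variable {n k j : ℕ} {X : Str}

theorem edgeRun_spec {b s : ℕ} (hb : b < (k + 1) * n) (hs : s < slotNum n X) :
    edgeRun n k j X b s < 2 * n + 3 ∧ (edgeRun n k j X b s = 0 ∨ 3 ≤ edgeRun n k j X b s ∧
      b + (edgeRun n k j X b s - 2) ≤ (k + 1) * n) := by
  have hn : 0 < n := Nat.pos_of_ne_zero (by rintro rfl; simp at hb)
  have hu : b % n < n := Nat.mod_lt b hn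
  have ht : b / n < k + 1 := (Nat.div_lt_iff_lt_mul hn).2 hb
  have hv : s / (len X + 1) < n := (Nat.div_lt_iff_lt_mul (Nat.succ_pos _)).2 hs
  have hdm := Nat.div_add_mod' b n
  rw [edgeRun]
  generalize s / (len X + 1) = v at *
  split_ifs with h
  · refine ⟨by omega, Or.inr ⟨by omega, ?_⟩⟩
    -- an edge from layer `t` leads to block `(t + 1) * n + v`, where `v = 0` if `t = k`
    rcases h with ⟨h, -⟩ | ⟨h, -, h', -⟩
    · have h₁ : b / n * n + 2 * n ≤ (k + 1) * n := by
        rw [← add_mul]; exact Nat.mul_le_mul_right n (by omega)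
      omega
    · rw [h] at hdm
      rw [h', add_mul]
      omega
  · exact ⟨by omega, Or.inl rfl⟩

theorem edgeRun_eq (hn : 0 < n) {t u v y : ℕ} (hu : u < n) (hy : y < len X + 1) :
    edgeRun n k j X (t * n + u) (v * (len X + 1) + y) =
      open Classical in if HasEdge k j X t u v y then n - u + v + 2 else 0 := by
  have h₁ : (t * n + u) / n = t := by
    rw [mul_comm, Nat.mul_add_div hn, Nat.div_eq_of_lt hu, add_zero]
  have h₂ : (t * n + u) % n = u := by
    rw [mul_comm, Nat.mul_add_mod, Nat.mod_eq_of_lt hu]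
  have h₃ : (v * (len X + 1) + y) / (len X + 1) = v := by
    rw [mul_comm, Nat.mul_add_div (Nat.succ_pos _), Nat.div_eq_of_lt hy, add_zero]
  have h₄ : (v * (len X + 1) + y) % (len X + 1) = y := by
    rw [mul_comm, Nat.mul_add_mod, Nat.mod_eq_of_lt hy]
  rw [edgeRun, h₁, h₂, h₃, h₄]

/-- The walker that starts in node `u` of layer `t` has as many accepting runs as there are walks of
length `k - t` from `u` to `j`, counted with multiplicity. -/
theorem scanCount_layer {d t : ℕ} (htd : t + d = k) (u j : Fin n) :
    Walker.scanCount (2 * n + 3)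
      (Walker.blocksFrom (slotNum n X) (edgeRun n k j X) ((k + 1) * n) (t * n + u)) =
    (unaryMatrix n X ^ d) u j := by
  classical
  have hn : 0 < n := (Nat.zero_le _).trans_lt u.2
  set V := fun b => Walker.scanCount (2 * n + 3)
    (Walker.blocksFrom (slotNum n X) (edgeRun n k j X) ((k + 1) * n) b) with hV
  have hstep : ∀ t : ℕ, t ≤ k → ∀ u : Fin n, V (t * n + u) = ∑ v ∈ Finset.range n,
      ∑ y ∈ Finset.range (len X + 1), if HasEdge k j X t u v y then V ((t + 1) * n + v) else 0 := by
    intro t ht u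
    have hb : t * n + u < (k + 1) * n := by
      have h : t * n + n ≤ (k + 1) * n := by
        rw [← Nat.succ_mul]; exact Nat.mul_le_mul_right n (by omega)
      omega
    simp only [hV]
    rw [Walker.scanCount_blocksFrom (by omega) (fun b hb s hs => edgeRun_spec hb hs) hb,
      slotNum, sum_range_mul]
    refine Finset.sum_congr rfl fun v _ => Finset.sum_congr rfl fun y hy => ?_
    rw [edgeRun_eq hn u.2 (Finset.mem_range.1 hy)]
    split_ifs with h
    · simp_all
    · rw [show t * n + ↑u + (n - ↑u + v + 2 - 2) = (t + 1) * n + v by rw [add_mul]; omega]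
    · rfl
    · simp_all
  change V (t * n + u) = _
  induction d generalizing t u with
  | zero =>
    obtain rfl : t = k := htd
    rw [hstep t le_rfl, pow_zero, Matrix.one_apply]
    have hexit : V ((t + 1) * n) = 1 := by
      simp only [hV, Walker.blocksFrom_self, Walker.scanCount_nil]
    have : ∀ v y, HasEdge t j X t u v y ↔ u = j ∧ v = 0 ∧ y = 0 := fun v y => by
      simp [HasEdge, Fin.ext_iff]
    simp only [this]
    by_cases huj : u = j
    · rw [if_pos huj, Finset.sum_eq_single_of_mem 0 (Finset.mem_range.2 hn),
        Finset.sum_eq_single_of_mem 0 (Finset.mem_range.2 (Nat.succ_pos _))]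
      · simp [huj, hexit]
      · intro y _ hy; simp [hy]
      · intro v _ hv; simp [hv]
    · simp [huj]
  | succ d ih =>
    rw [hstep t (by omega), pow_succ', Matrix.mul_apply, ← Fin.sum_univ_eq_sum_range
      (fun v => ∑ y ∈ Finset.range (len X + 1),
        if HasEdge k j X t u v y then V ((t + 1) * n + v) else 0) n]
    refine Finset.sum_congr rfl fun v _ => ?_
    rw [ih (t := t + 1) (by omega) v, ← Finset.sum_filter, Finset.sum_const, smul_eq_mul]
    congr 1
    have : (Finset.range (len X + 1)).filter (fun y => HasEdge k j X t u v y) =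
        Finset.range (entry u v X) := by
      ext y
      have := entry_le u v X
      rw [Finset.mem_filter]
      simp only [Finset.mem_range, HasEdge]
      omega
    rw [this, Finset.card_range]
    rfl

/-- The walker computes the entries of matrix powers from the strings of slots. -/
theorem walks_slotStr (i j : Fin n) :
    Walker.walks ![(i : ℕ)] ![slotStr ![n, k, j] ![X]] =
      binStr ((unaryMatrix n X ^ k) i j) := by
  have hi : (i : ℕ) ≤ (k + 1) * n := by
    rw [Nat.succ_mul]; omega
  rw [Walker.mem_walks_iff (S := slotNum n X) (W := 2 * n + 3) (B := (k + 1) * n)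
    (f := edgeRun n k j X) (by omega)
    (fun b hb s hs => ⟨(edgeRun_spec hb hs).1, (edgeRun_spec hb hs).2.imp_right And.left⟩)
    (fun p => by rw [mem_slotStr]; exact slotBit_iff) hi,
    ← scanCount_layer (t := 0) (Nat.zero_add k) i j]
  simp

end

/-- Matrix powering is reducible to the walker's function by way of `slotStr`. -/
theorem strReducible_unaryMatrixPowering : StrReducible unaryMatrixPowering sharpL := by
  refine ⟨[⟨3, 1, slotStr⟩], ⟨strDefinable_slotStr _, trivial⟩, ?_⟩
  set L := sharpL.adjoin [⟨3, 1, slotStr⟩]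
  refine StrDefinable.of_relDef
    (fun x X => pair (x 0) (pair (x 0) (x 0 * len (X 0) * x 1 + 1)) + 1)
    (fun x X b hb => lt_of_mem_unaryMatrixPowering hb) ?_
  refine RelDef.congr (R := fun z X => ∃ i, i ≤ z 0 ∧ ∃ j, j ≤ z 0 ∧ ∃ l, l ≤ z 0 ∧
    (z 0 = pair i (pair j l) ∧ i < z (Fin.succ 0) ∧ j < z (Fin.succ 0) ∧
      l ∈ Walker.walks ![i] ![slotStr ![z (Fin.succ 0), z (Fin.succ 1), j] ![X 0]]))
    (fun z X => ?_) ?_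
  · rw [unaryMatrixPowering, mem_encodeBinaryMatrix]
    constructor
    · rintro ⟨i, -, j, -, l, -, hb, hi, hj, hl⟩
      exact ⟨⟨i, hi⟩, ⟨j, hj⟩, l, (walks_slotStr ⟨i, hi⟩ ⟨j, hj⟩) ▸ hl, hb⟩
    · rintro ⟨i, j, l, hl, hb⟩
      refine ⟨i, ?_, j, ?_, l, ?_, hb, i.2, j.2, ?_⟩
      · rw [hb]; exact le_pair_left _ _
      · rw [hb]; exact (le_pair_left _ _).trans (le_pair_right _ _)
      · rw [hb]; exact (le_pair_right _ _).trans (le_pair_right _ _)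
      · rw [walks_slotStr i j]; exact hl
  · -- below the quantifiers, the number variables are `l`, `j`, `i`, the bit, `n`, `k` in this
    -- order; they are written with `Fin.succ` as this is the form that instance search meets
    have hG : StrTermDef L (fun (z : Fin 6 → ℕ) (X : Fin 1 → Str) =>
        slotStr ![z (Fin.succ (Fin.succ (Fin.succ (Fin.succ 0)))),
          z (Fin.succ (Fin.succ (Fin.succ (Fin.succ 1)))), z (Fin.succ 0)] ![X 0]) :=
      StrTermDef.app (F := slotStr) (show _ ∈ L.str 3 1 from Or.inr List.mem_cons_self)
        (by simp only [Fin.forall_fin_succ]; exact ⟨.var _, .var _, .var _, nofun⟩)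
        (Fin.forall_fin_one.2 (.var 0))
    have hW : StrTermDef L (fun (z : Fin 6 → ℕ) (X : Fin 1 → Str) => Walker.walks
        ![z (Fin.succ (Fin.succ 0))] ![slotStr ![z (Fin.succ (Fin.succ (Fin.succ (Fin.succ 0)))),
          z (Fin.succ (Fin.succ (Fin.succ (Fin.succ 1)))), z (Fin.succ 0)] ![X 0]]) :=
      StrTermDef.app (F := Walker.walks) (show _ ∈ L.str 1 1 from Or.inl Walker.isSharpL_walks)
        (Fin.forall_fin_one.2 (.var _)) (Fin.forall_fin_one.2 hG)
    infer_instance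

end TwoSorted

theorem mainTheorem6 :
    TwoSorted.IsACZeroComplete TwoSorted.unaryMatrixPowering TwoSorted.DET := by
  refine ⟨TwoSorted.strReducible_unaryMatrixPowering, fun a b G hG => ?_, fun a b g hg => ?_⟩
  · exact TwoSorted.StrReducible.trans hG (fun _ _ => Set.empty_subset _)
      (fun _ _ => Set.empty_subset _) fun _ _ F hF => TwoSorted.IsSharpL.exists_definableSeq hF
  · exact TwoSorted.NumReducible.trans hg (fun _ _ => Set.empty_subset _)
      (fun _ _ => Set.empty_subset _) fun _ _ F hF => TwoSorted.IsSharpL.exists_definableSeq hF
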